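/- Let $K$ be a field, $n\ge 0$, and let $S=K[x_1,\dots,x_n]$ have the standard grading, with $\mathfrak m=(x_1,\dots,x_n)$. Let $I\subseteq S$ be a strongly stable ideal, that is, a monomial ideal such that whenever a monomial $m\in I$ is divisible by a variable $x_i$, then $m x_j/x_i\in I$ for every $j<i$. Let $\operatorname{reg}_S(I)=\sup\{\,j-i : i,j\in\mathbb N,\ \operatorname{Tor}_i^S(I,K)_j\neq 0\,\}$ be the Castelnuovo–Mumford regularity of $I$ (so $\operatorname{reg}_S(0)=-\infty$). Let $\phi:F=\bigoplus_{k=1}^r S(-d_k)\to S$ be an $S$-linear map, homogeneous of degree $0$, with image $I$ and $\ker\phi\subseteq\mathfrak m F$; that is, the images of the basis vectors form a minimal system of homogeneous generators of $I$, of degrees $d_1,\dots,d_r$. Let $K(\phi,S)=\bigwedge^\bullet F$ be the Koszul complex of $\phi$, with its induced internal grading, and let $Z_t=Z_t(I,S)\subseteq\bigwedge^t F$ be its graded $S$-module of cycles in homological degree $t$. Then, for every integer $t\ge 0$, the $S$-module $Z_t$ is generated by homogeneous elements of internal degree $\le t(\operatorname{reg}_S(I)+1)$ (for $t=0$ the bound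 is read as $0$, also when $I=0$). -/

import Mathlib

open MvPolynomial

attribute [local instance] MvPolynomial.gradedAlgebra

namespace KoszulCycles

noncomputable section

variable {K : Type*} [Field K] {n : ℕ}

/-! ### Graded free modules over `S = K[x_1, …, x_n]` -/

/-- For a shift vector `e`, the degree-`q` component of the graded free module
`F = ⨁ l, S(-e l)`, realised on `Fin b → S`; the `l`-th basis vector has degree `e l`.
So `v` lies in `F_q` iff every monomial of the `l`-th coordinate has degree `q - e l`
(and the coordinate vanishes if `q < e l`). -/
def freeComponent (K : Type*) [Field K] (n : ℕ) {b : ℕ} (e : Fin b → ℕ) (q : ℕ) :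
    Submodule K (Fin b → MvPolynomial (Fin n) K) where
  carrier := {v | ∀ l, ∀ c ∈ (v l).support, c.degree + e l = q}
  zero_mem' := by simp
  add_mem' := by
    intro v w hv hw l c hc
    rcases Finset.mem_union.1 (MvPolynomial.support_add hc) with h | h
    exacts [hv l c h, hw l c h]
  smul_mem' := by
    intro a v hv l c hc
    exact hv l c (MvPolynomial.support_smul hc)

/-- The projection of `⨁ l, S(-e l)` onto its degree-`q` component. -/
def freeProj {b : ℕ} (e : Fin b → ℕ) (q : ℕ) (v : Fin b → MvPolynomial (Fin n) K) :
    Fin b → MvPolynomial (Fin n) K :=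
  fun l => if e l ≤ q then homogeneousComponent (q - e l) (v l) else 0

/-- An `S`-linear map of graded free modules is homogeneous of degree `0` if it sends every basis
vector to an element of the same degree. -/
def IsGradedMap {b b' : ℕ} (e' : Fin b' → ℕ) (e : Fin b → ℕ)
    (A : (Fin b' → MvPolynomial (Fin n) K) →ₗ[MvPolynomial (Fin n) K]
      (Fin b → MvPolynomial (Fin n) K)) : Prop :=
  ∀ k, A (Pi.single k 1) ∈ freeComponent K n e (e' k)

/-! ### Graded free resolutions, graded Betti numbers and regularity -/

/-- A graded free resolution `⋯ → F_2 → F_1 → F_0 → I → 0` of an ideal `I` of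
`S = K[x_1, …, x_n]`, with finitely generated `F_i = ⨁ k, S(-deg i k)`; it need not be minimal. -/
structure GradedFreeResolution (I : Ideal (MvPolynomial (Fin n) K)) where
  rank : ℕ → ℕ
  deg : ∀ i, Fin (rank i) → ℕ
  aug : (Fin (rank 0) → MvPolynomial (Fin n) K) →ₗ[MvPolynomial (Fin n) K] MvPolynomial (Fin n) K
  d : ∀ i, (Fin (rank (i + 1)) → MvPolynomial (Fin n) K) →ₗ[MvPolynomial (Fin n) K]
    (Fin (rank i) → MvPolynomial (Fin n) K)
  aug_graded : ∀ k, (aug (Pi.single k 1)).IsHomogeneous (deg 0 k)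
  d_graded : ∀ i, IsGradedMap (deg (i + 1)) (deg i) (d i)
  range_aug : LinearMap.range aug = I
  exact_zero : Function.Exact (d 0) aug
  exact_succ : ∀ i, Function.Exact (d (i + 1)) (d i)

namespace GradedFreeResolution

variable {I : Ideal (MvPolynomial (Fin n) K)} (F : GradedFreeResolution I)

/-- The differential `F_{i+1} ⊗ K → F_i ⊗ K`, where `K = S/𝔪`: its matrix consists of the constant
coefficients of the matrix of `d i`. -/
def redD (i : ℕ) : (Fin (F.rank (i + 1)) → K) →ₗ[K] (Fin (F.rank i) → K) :=
  Matrix.toLin' ((LinearMap.toMatrix' (F.d i)).map constantCoeff)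

/-- The cycles of the complex `F ⊗ K` in homological degree `i`. -/
def cycles : ∀ i, Submodule K (Fin (F.rank i) → K)
  | 0 => ⊤
  | i + 1 => LinearMap.ker (F.redD i)

/-- The boundaries of the complex `F ⊗ K` in homological degree `i`. -/
def boundaries (i : ℕ) : Submodule K (Fin (F.rank i) → K) := LinearMap.range (F.redD i)

/-- The degree-`j` component of `F_i ⊗ K = ⨁ k, K(-deg i k)`. -/
def redComponent (i j : ℕ) : Submodule K (Fin (F.rank i) → K) where
  carrier := {v | ∀ k, F.deg i k ≠ j → v k = 0}
  zero_mem' := by simp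
  add_mem' := by
    intro v w hv hw k hk
    simp [hv k hk, hw k hk]
  smul_mem' := by
    intro a v hv k hk
    simp [hv k hk]

/-- `dim_K H_i(F ⊗ K)_j = dim_K Tor_i(I, K)_j`. -/
def betti (i j : ℕ) : ℕ :=
  Module.finrank K
    (↥(F.cycles i ⊓ F.redComponent i j) ⧸
      (F.boundaries i ⊓ F.redComponent i j).submoduleOf (F.cycles i ⊓ F.redComponent i j))

end GradedFreeResolution

/-! Existence of graded free resolutions of homogeneous ideals. -/

section existence

theorem freeProj_mem {b : ℕ} (e : Fin b → ℕ) (q : ℕ) (v : Fin b → MvPolynomial (Fin n) K) :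
    freeProj e q v ∈ freeComponent K n e q := by
  intro l c hc
  unfold freeProj at hc
  split_ifs at hc with h
  · rw [mem_support_iff, coeff_homogeneousComponent] at hc
    have : c.degree = q - e l := by
      by_contra h'
      simp [h'] at hc
    omega
  · simp at hc

theorem coeff_freeProj {b : ℕ} (e : Fin b → ℕ) (q : ℕ) (v : Fin b → MvPolynomial (Fin n) K)
    (l : Fin b) (c : Fin n →₀ ℕ) :
    coeff c (freeProj e q v l) = if c.degree + e l = q then coeff c (v l) else 0 := by
  unfold freeProj
  by_cases h : e l ≤ q
  · rw [if_pos h, coeff_homogeneousComponent]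
    congr 1
    rw [eq_iff_iff]
    omega
  · rw [if_neg h, if_neg (by omega), coeff_zero]

theorem exists_sum_freeProj {b : ℕ} (e : Fin b → ℕ) (v : Fin b → MvPolynomial (Fin n) K) :
    ∃ Q, ∑ q ∈ Finset.range Q, freeProj e q v = v := by
  refine ⟨(∑ l, ((v l).totalDegree + e l)) + 1, ?_⟩
  funext l
  ext c
  rw [Finset.sum_apply, coeff_sum]
  simp only [coeff_freeProj]
  rw [Finset.sum_ite_eq]
  split_ifs with h
  · rfl
  · by_contra h'
    apply h
    have h1 : c.degree ≤ (v l).totalDegree := by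
      have := le_totalDegree (mem_support_iff.2 (Ne.symm h'))
      exact this
    have h2 := Finset.single_le_sum (f := fun l => (v l).totalDegree + e l)
      (fun _ _ => Nat.zero_le _) (Finset.mem_univ l)
    rw [Finset.mem_range]
    omega

/-- A submodule of a graded free module is homogeneous if it contains the components of its
elements. -/
def IsHomog {b : ℕ} (e : Fin b → ℕ)
    (N : Submodule (MvPolynomial (Fin n) K) (Fin b → MvPolynomial (Fin n) K)) : Prop :=
  ∀ v ∈ N, ∀ q, freeProj e q v ∈ N

theorem IsGradedMap.map_mem {b b' : ℕ} {e' : Fin b' → ℕ} {e : Fin b → ℕ}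
    {A : (Fin b' → MvPolynomial (Fin n) K) →ₗ[MvPolynomial (Fin n) K]
      (Fin b → MvPolynomial (Fin n) K)} (hA : IsGradedMap e' e A) {q : ℕ}
    {v : Fin b' → MvPolynomial (Fin n) K} (hv : v ∈ freeComponent K n e' q) :
    A v ∈ freeComponent K n e q := by
  have hsum : A v = ∑ k, v k • A (Pi.single k 1) := by
    conv_lhs => rw [pi_eq_sum_univ' v]
    simp only [map_sum, map_smul]
  rw [hsum]
  refine Submodule.sum_mem _ fun k _ l c hc => ?_
  simp only [Pi.smul_apply, smul_eq_mul] at hc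
  obtain ⟨a, ha, a', ha', rfl⟩ := Finset.mem_add.1 (MvPolynomial.support_mul _ _ hc)
  have h1 := hv k a ha
  have h2 := hA k l a' ha'
  rw [map_add]
  omega

theorem IsGradedMap.isHomog_ker {b b' : ℕ} {e' : Fin b' → ℕ} {e : Fin b → ℕ}
    {A : (Fin b' → MvPolynomial (Fin n) K) →ₗ[MvPolynomial (Fin n) K]
      (Fin b → MvPolynomial (Fin n) K)} (hA : IsGradedMap e' e A) :
    IsHomog e' (LinearMap.ker A) := by
  intro v hv q
  obtain ⟨Q, hQ⟩ := exists_sum_freeProj e' v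
  rw [LinearMap.mem_ker] at hv ⊢
  have hmem : ∀ p, A (freeProj e' p v) ∈ freeComponent K n e p := fun p =>
    hA.map_mem (freeProj_mem e' p v)
  have hzero : ∀ p (l : Fin b) (c : Fin n →₀ ℕ), c.degree + e l ≠ p →
      coeff c (A (freeProj e' p v) l) = 0 := by
    intro p l c h
    by_contra h'
    exact h (hmem p l c (mem_support_iff.2 h'))
  by_cases hq : q ∈ Finset.range Q
  · funext l
    ext c
    by_cases h : c.degree + e l = q
    · have h0 : coeff c (A v l) = 0 := by rw [hv]; simp
      rw [← hQ, map_sum, Finset.sum_apply, coeff_sum, Finset.sum_eq_single q] at h0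
      · simpa using h0
      · intro p _ hp
        exact hzero p l c (fun h' => hp (h'.symm.trans h))
      · exact fun h' => absurd hq h'
    · simpa using hzero q l c h
  · have : freeProj e' q v = 0 := by
      funext l
      ext c
      rw [coeff_freeProj]
      split_ifs with h
      · rw [← hQ, Finset.sum_apply, coeff_sum, Finset.sum_eq_zero]
        · simp
        · intro p hp
          rw [coeff_freeProj, if_neg]
          rintro rfl
          exact hq (h ▸ hp)
      · simp
    rw [this, map_zero]

/-- Every homogeneous submodule is the image of a graded map from a graded free module. -/
theorem exists_gradedMap {b : ℕ} (e : Fin b → ℕ)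
    (N : Submodule (MvPolynomial (Fin n) K) (Fin b → MvPolynomial (Fin n) K)) (hN : IsHomog e N) :
    ∃ (b' : ℕ) (e' : Fin b' → ℕ) (A : (Fin b' → MvPolynomial (Fin n) K) →ₗ[MvPolynomial (Fin n) K]
      (Fin b → MvPolynomial (Fin n) K)), IsGradedMap e' e A ∧ LinearMap.range A = N := by
  classical
  obtain ⟨G, hG⟩ := (IsNoetherian.noetherian N : N.FG)
  choose Q hQ using fun v : Fin b → MvPolynomial (Fin n) K => exists_sum_freeProj e v
  let T : Finset (Σ _ : Fin b → MvPolynomial (Fin n) K, ℕ) := G.sigma fun v => Finset.range (Q v)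
  let w : Fin T.card → Fin b → MvPolynomial (Fin n) K := fun k =>
    freeProj e (T.equivFin.symm k).1.2 (T.equivFin.symm k).1.1
  refine ⟨T.card, fun k => (T.equivFin.symm k).1.2,
    Fintype.linearCombination (MvPolynomial (Fin n) K) w, ?_, ?_⟩
  · intro k
    rw [Fintype.linearCombination_apply_single, one_smul]
    exact freeProj_mem e _ _
  · rw [Fintype.range_linearCombination]
    apply le_antisymm
    · rw [Submodule.span_le]
      rintro _ ⟨k, rfl⟩
      refine hN _ ?_ _
      rw [← hG]
      exact Submodule.subset_span (Finset.mem_sigma.1 (T.equivFin.symm k).2).1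
    · rw [← hG, Submodule.span_le]
      intro v hv
      rw [← hQ v]
      refine Submodule.sum_mem _ fun q hq => Submodule.subset_span ?_
      have hT : (⟨v, q⟩ : Σ _ : Fin b → MvPolynomial (Fin n) K, ℕ) ∈ T :=
        Finset.mem_sigma.2 ⟨hv, hq⟩
      exact ⟨T.equivFin ⟨⟨v, q⟩, hT⟩, by simp [w]⟩

/-- A homogeneous submodule of a graded free module (one stage of the construction of a
resolution). -/
structure Stage (K : Type*) [Field K] (n : ℕ) where
  b : ℕ
  e : Fin b → ℕ
  N : Submodule (MvPolynomial (Fin n) K) (Fin b → MvPolynomial (Fin n) K)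
  homog : IsHomog e N

namespace Stage

variable (s : Stage K n)

/-- A graded map with image `s.N`. -/
def cover : (Fin (exists_gradedMap s.e s.N s.homog).choose → MvPolynomial (Fin n) K)
    →ₗ[MvPolynomial (Fin n) K] (Fin s.b → MvPolynomial (Fin n) K) :=
  (exists_gradedMap s.e s.N s.homog).choose_spec.choose_spec.choose

/-- The degrees of the basis of the source of `s.cover`. -/
def coverDeg : Fin (exists_gradedMap s.e s.N s.homog).choose → ℕ :=
  (exists_gradedMap s.e s.N s.homog).choose_spec.choose

theorem cover_graded : IsGradedMap s.coverDeg s.e s.cover :=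
  (exists_gradedMap s.e s.N s.homog).choose_spec.choose_spec.choose_spec.1

theorem range_cover : LinearMap.range s.cover = s.N :=
  (exists_gradedMap s.e s.N s.homog).choose_spec.choose_spec.choose_spec.2

/-- The kernel of `s.cover`. -/
def next : Stage K n where
  b := _
  e := s.coverDeg
  N := LinearMap.ker s.cover
  homog := s.cover_graded.isHomog_ker

theorem exact_next : Function.Exact s.next.cover s.cover :=
  LinearMap.exact_iff.2 s.next.range_cover.symm

/-- The iterated syzygies. -/
def seq : ℕ → Stage K n
  | 0 => s.next
  | i + 1 => (seq i).next

end Stage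

/-- The ideal `I`, as a submodule of `S^1`. -/
def idealStage (I : Ideal (MvPolynomial (Fin n) K))
    (hI : I.IsHomogeneous (homogeneousSubmodule (Fin n) K)) : Stage K n where
  b := 1
  e := fun _ => 0
  N := Submodule.comap (LinearMap.proj 0) I
  homog := by
    intro v hv q
    simp only [Submodule.mem_comap, LinearMap.proj_apply] at hv ⊢
    simpa [freeProj] using homogeneousComponent_mem_of_mem hI hv q

theorem exists_gradedFreeResolution (I : Ideal (MvPolynomial (Fin n) K))
    (hI : I.IsHomogeneous (homogeneousSubmodule (Fin n) K)) :
    Nonempty (GradedFreeResolution I) := by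
  let s := idealStage I hI
  let π : (Fin s.b → MvPolynomial (Fin n) K) →ₗ[MvPolynomial (Fin n) K] MvPolynomial (Fin n) K :=
    LinearMap.proj (0 : Fin 1)
  have hinj : ∀ v, π v = 0 → v = 0 := by
    intro v h
    funext l
    rw [show l = (0 : Fin 1) from Subsingleton.elim (α := Fin 1) _ _]
    exact h
  have hrange : LinearMap.range (π.comp s.cover) = I := by
    rw [LinearMap.range_comp, s.range_cover]
    exact Submodule.map_comap_eq_of_surjective
      (LinearMap.proj_surjective (φ := fun _ : Fin 1 => MvPolynomial (Fin n) K) 0) _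
  have hexact : Function.Exact s.next.cover (π.comp s.cover) := fun v =>
    ⟨fun h => (s.exact_next v).1 (hinj _ h), fun h =>
      (congrArg π ((s.exact_next v).2 h)).trans (map_zero π)⟩
  have hdeg : ∀ k, (π.comp s.cover (Pi.single k 1)).IsHomogeneous (s.coverDeg k) := by
    intro k c hc
    have h := s.cover_graded k (0 : Fin 1) c (mem_support_iff.2 hc)
    have h' : c.degree = s.coverDeg k := h
    rw [← h', Finsupp.degree_eq_weight_one]
    rfl
  exact ⟨{ rank := fun i => (s.seq i).b
           deg := fun i => (s.seq i).e
           aug := π.comp s.cover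
           d := fun i => (s.seq i).cover
           aug_graded := hdeg
           d_graded := fun i => (s.seq i).cover_graded
           range_aug := hrange
           exact_zero := hexact
           exact_succ := fun i => (s.seq i).exact_next }⟩

end existence

/-- A graded free resolution of a homogeneous ideal. -/
def resolution (I : Ideal (MvPolynomial (Fin n) K))
    (hI : I.IsHomogeneous (homogeneousSubmodule (Fin n) K)) : GradedFreeResolution I :=
  (exists_gradedFreeResolution I hI).some

/-- The graded Betti number `β_{i,j}(I) = dim_K Tor_i(I, K)_j`, where `Tor` is computed as
the homology of `F ⊗ K` for a graded free resolution `F` of `I`. -/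
def gradedBetti (I : Ideal (MvPolynomial (Fin n) K))
    (hI : I.IsHomogeneous (homogeneousSubmodule (Fin n) K)) (i j : ℕ) : ℕ :=
  (resolution I hI).betti i j

/-- `t_i(I) = max {j | β_{i,j}(I) ≠ 0}`, which is `-∞` if all these Betti numbers vanish. -/
def topDegree (I : Ideal (MvPolynomial (Fin n) K))
    (hI : I.IsHomogeneous (homogeneousSubmodule (Fin n) K)) (i : ℕ) : EReal :=
  ⨆ (j : ℕ) (_ : gradedBetti I hI i j ≠ 0), (j : EReal)

/-- The Castelnuovo–Mumford regularity `reg_S(I) = sup {t_i(I) - i | i ∈ ℕ}`. -/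
def regularity (I : Ideal (MvPolynomial (Fin n) K))
    (hI : I.IsHomogeneous (homogeneousSubmodule (Fin n) K)) : EReal :=
  ⨆ i : ℕ, (topDegree I hI i - (i : EReal))

/-! ### Strongly stable ideals -/

/-- `I` is a monomial ideal such that whenever a monomial `m ∈ I` is divisible by `x_i`, then
`m x_j / x_i ∈ I` for every `j < i`. -/
structure IsStronglyStable (I : Ideal (MvPolynomial (Fin n) K)) : Prop where
  isMonomial : ∃ A : Set (Fin n →₀ ℕ), I = Ideal.span ((fun a => monomial a (1 : K)) '' A)
  exchange : ∀ a : Fin n →₀ ℕ, monomial a (1 : K) ∈ I → ∀ i, a i ≠ 0 → ∀ j < i,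
    monomial (a - Finsupp.single i 1 + Finsupp.single j 1) (1 : K) ∈ I

theorem IsStronglyStable.isHomogeneous {I : Ideal (MvPolynomial (Fin n) K)}
    (hI : IsStronglyStable I) : I.IsHomogeneous (homogeneousSubmodule (Fin n) K) := by
  obtain ⟨A, rfl⟩ := hI.isMonomial
  refine Ideal.homogeneous_span _ _ ?_
  rintro _ ⟨a, -, rfl⟩
  exact ⟨a.degree, isHomogeneous_monomial _ rfl⟩

/-! ### The Koszul complex -/

/-- A minimal graded free presentation `φ : F = ⨁ k, S(-deg k) → S` of the ideal `I`:
`φ` is homogeneous of degree `0`, has image `I`, and `ker φ ⊆ 𝔪 F`. Equivalently, the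
`φ (e_k)` form a minimal system of homogeneous generators of `I`. -/
structure MinimalPresentation (I : Ideal (MvPolynomial (Fin n) K)) where
  rank : ℕ
  deg : Fin rank → ℕ
  φ : (Fin rank → MvPolynomial (Fin n) K) →ₗ[MvPolynomial (Fin n) K] MvPolynomial (Fin n) K
  graded : ∀ k, (φ (Pi.single k 1)).IsHomogeneous (deg k)
  range_eq : LinearMap.range φ = I
  minimal : LinearMap.ker φ ≤ idealOfVars (Fin n) K •
    (⊤ : Submodule (MvPolynomial (Fin n) K) (Fin rank → MvPolynomial (Fin n) K))

namespace MinimalPresentation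

variable {I : Ideal (MvPolynomial (Fin n) K)} (P : MinimalPresentation I)

/-- The differential of the Koszul complex `K(φ, S) = ⋀ F`: the antiderivation with
`v ∧ x ↦ φ(v) x - v ∧ ∂x` for `v ∈ F`. -/
def koszulDifferential :
    ExteriorAlgebra (MvPolynomial (Fin n) K) (Fin P.rank → MvPolynomial (Fin n) K)
      →ₗ[MvPolynomial (Fin n) K]
    ExteriorAlgebra (MvPolynomial (Fin n) K) (Fin P.rank → MvPolynomial (Fin n) K) :=
  CliffordAlgebra.contractLeft P.φ

/-- The module `Z_t(I, S)` of Koszul cycles in homological degree `t`. -/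
def koszulCycles (t : ℕ) : Submodule (MvPolynomial (Fin n) K)
    (ExteriorAlgebra (MvPolynomial (Fin n) K) (Fin P.rank → MvPolynomial (Fin n) K)) :=
  ExteriorAlgebra.exteriorPower (MvPolynomial (Fin n) K) t (Fin P.rank → MvPolynomial (Fin n) K) ⊓
    LinearMap.ker P.koszulDifferential

/-- The component of internal degree `q` of `⋀^t F`: it is spanned over `K` by the elements
`p e_{s_1} ∧ ⋯ ∧ e_{s_t}` with `p` homogeneous of degree `m` and
`m + deg s_1 + ⋯ + deg s_t = q`. -/
def koszulComponent (t q : ℕ) : Submodule K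
    (ExteriorAlgebra (MvPolynomial (Fin n) K) (Fin P.rank → MvPolynomial (Fin n) K)) :=
  Submodule.span K {z | ∃ (s : Fin t → Fin P.rank) (m : ℕ) (p : MvPolynomial (Fin n) K),
    p.IsHomogeneous m ∧ m + ∑ a, P.deg (s a) = q ∧
    z = p • ExteriorAlgebra.ιMulti (MvPolynomial (Fin n) K) t
      (fun a => (Pi.single (s a) 1 : Fin P.rank → MvPolynomial (Fin n) K))}

end MinimalPresentation

end

end KoszulCycles

/-! Let `d` be the largest degree of a generator. A generator of degree `j` forces `Tor_0` to be
nonzero in degree `j`, so `d ≤ reg I`, and it suffices to prove the bound `t * (d + 1)`.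

Let `G` be the set of all monomials of `I` of degree at most `d`; it is closed under the strongly
stable exchanges. The Koszul complex on `G` is multigraded. After setting the variables to `1`, its
component of multidegree `a` is spanned by the products of `t` generators whose monomials multiply
to a divisor of `x^a` (`chains`), and the differential sends every generator to `1` (`augDiff`). The
combinatorial core is `cycle_mem_lowCycles`: each cycle of multidegree `a` is a sum of cycles of
multidegrees `c ≤ a` with `|c| ≤ t * (d + 1)`.

Its inductive step is `mem_lowCycles_sup_chains`. Let `x_k` be the last variable allowed in `a`, and
let `|a|` be large. Split off a monomial `u` divisible by `x_k`, so that `z = z₀ + u z₁`.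
Inductively `z₁` is a sum of low cycles, up to chains whose product with `u` already fits under `a -
e_k`. For a low cycle `y` of multidegree `c`, the inequality `deg u ≤ d` leaves room in `x^a / (x^c
u)` for some `x_j` with `j ≤ k`. If `j = k`, then `u y` fits under `a - e_k`. If `j < k`, the
exchange gives `u' = u x_j / x_k` in `G`. Then `(u - u') y` is a cycle of multidegree `c + u + e_j`,
while `u' y` fits under `a - e_k`. Each factor thus costs at most `d` for `u` and `1` for `x_j`.

The generators `φ (e_k)` need not be monomials. By minimality, the monomials of `I` have homogeneous
lifts to `F` compatible with the basis (`exists_monomial_lift`). Expanding `φ (e_k)` into monomials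
(`dehom`) and substituting the lifts (`homog`) are compatible with the differentials and compose to
the identity. So the Koszul complex of `φ` is a retract of the one on `G` and inherits the bound. -/

namespace KoszulCycles

noncomputable section

variable {K : Type*} [Field K] {n : ℕ}

section

/-! ### The dehomogenized Koszul complex on all monomials -/

/-- The exterior algebra over `K` on the monomials of `K[x_1, …, x_n]`. -/
abbrev MonExt (K : Type*) [Field K] (n : ℕ) := ExteriorAlgebra K ((Fin n →₀ ℕ) →₀ K)

/-- The generator of `MonExt K n` belonging to a monomial. -/
def monGen (g : Fin n →₀ ℕ) : MonExt K n := ExteriorAlgebra.ι K (Finsupp.single g 1)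

/-- The antiderivation sending every generator to `1`. -/
def augDiff : MonExt K n →ₗ[K] MonExt K n :=
  CliffordAlgebra.contractLeft (Finsupp.linearCombination K (fun _ : Fin n →₀ ℕ => (1 : K)))

/-- The contraction by the coordinate of the generator `monGen u`. -/
def delGen (u : Fin n →₀ ℕ) : MonExt K n →ₗ[K] MonExt K n :=
  CliffordAlgebra.contractLeft (Finsupp.lapply u)

theorem augDiff_mul (g : Fin n →₀ ℕ) (w : MonExt K n) :
    augDiff (monGen g * w) = w - monGen g * augDiff w := by
  unfold augDiff monGen
  refine (CliffordAlgebra.contractLeft_ι_mul _ _ _).trans ?_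
  simp [ExteriorAlgebra.ι]

theorem augDiff_one : augDiff (1 : MonExt K n) = 0 :=
  CliffordAlgebra.contractLeft_one (Q := 0) _

theorem delGen_mul (u g : Fin n →₀ ℕ) (w : MonExt K n) :
    delGen u (monGen g * w) = (if g = u then w else 0) - monGen g * delGen u w := by
  unfold delGen monGen
  refine (CliffordAlgebra.contractLeft_ι_mul _ _ _).trans ?_
  by_cases h : g = u <;> simp [ExteriorAlgebra.ι, h]

theorem delGen_one (u : Fin n →₀ ℕ) : delGen u (1 : MonExt K n) = 0 :=
  CliffordAlgebra.contractLeft_one (Q := 0) _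

theorem augDiff_delGen (u : Fin n →₀ ℕ) (w : MonExt K n) :
    augDiff (delGen u w) = - delGen u (augDiff w) :=
  CliffordAlgebra.contractLeft_comm _ _ _

theorem monGen_mul_self (g : Fin n →₀ ℕ) : (monGen g * monGen g : MonExt K n) = 0 :=
  ExteriorAlgebra.ι_sq_zero _

theorem monGen_anticomm (g h : Fin n →₀ ℕ) :
    (monGen g * monGen h : MonExt K n) = - (monGen h * monGen g) :=
  eq_neg_of_add_eq_zero_left (ExteriorAlgebra.ι_add_mul_swap _ _)

/-- The exponent vector of a monomial, with entries in `ℤ`. -/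
def toZ (g : Fin n →₀ ℕ) : Fin n → ℤ := fun i => (g i : ℤ)

theorem toZ_add (g h : Fin n →₀ ℕ) : toZ (g + h) = toZ g + toZ h := by
  funext i; simp [toZ]

theorem toZ_zero : toZ (0 : Fin n →₀ ℕ) = 0 := by
  funext i; simp [toZ]

theorem toZ_nonneg (g : Fin n →₀ ℕ) : 0 ≤ toZ g := fun i => by simp [toZ]

theorem toZ_le_toZ {g h : Fin n →₀ ℕ} : toZ g ≤ toZ h ↔ g ≤ h := by
  simp [toZ, Pi.le_def, Finsupp.le_def]

theorem sum_toZ (g : Fin n →₀ ℕ) : ∑ i, toZ g i = (g.degree : ℤ) := by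
  simp [toZ, Finsupp.degree_eq_sum]

/-- The span of the products of `t` generators from `A` whose total exponent is at most `a`. -/
def chains (A : Set (Fin n →₀ ℕ)) (a : Fin n → ℤ) (t : ℕ) : Submodule K (MonExt K n) :=
  Submodule.span K {w | ∃ l : List (Fin n →₀ ℕ), l.length = t ∧ (∀ g ∈ l, g ∈ A) ∧
    toZ l.sum ≤ a ∧ w = (l.map monGen).prod}

variable {A B G : Set (Fin n →₀ ℕ)} {a b : Fin n → ℤ} {t : ℕ}

/-! ### Calculus of chains under multiplication and contraction -/

theorem prod_mem_chains {l : List (Fin n →₀ ℕ)} (h1 : l.length = t) (h2 : ∀ g ∈ l, g ∈ A)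
    (h3 : toZ l.sum ≤ a) : ((l.map monGen).prod : MonExt K n) ∈ chains A a t :=
  Submodule.subset_span ⟨l, h1, h2, h3, rfl⟩

theorem chains_mono (hAB : A ⊆ B) (hab : a ≤ b) (t : ℕ) :
    (chains A a t : Submodule K (MonExt K n)) ≤ chains B b t := by
  refine Submodule.span_mono ?_
  rintro _ ⟨l, h1, h2, h3, rfl⟩
  exact ⟨l, h1, fun g hg => hAB (h2 g hg), h3.trans hab, rfl⟩

/-- Exponent bounds are integer vectors so that `a - e_k` and `a - toZ u` need no side condition. A
negative entry leaves no chains at all, and this ends several inductions. -/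
theorem chains_eq_bot {i : Fin n} (hi : a i < 0) :
    (chains A a t : Submodule K (MonExt K n)) = ⊥ := by
  rw [chains, Submodule.span_eq_bot]
  rintro _ ⟨l, -, -, h3, -⟩
  exact absurd ((toZ_nonneg _ i).trans (h3 i)) (not_le.2 hi)

theorem monGen_mul_mem {g : Fin n →₀ ℕ} (hg : g ∈ A) {w : MonExt K n}
    (hw : w ∈ chains A (a - toZ g) t) : monGen g * w ∈ chains A a (t + 1) := by
  induction hw using Submodule.span_induction with
  | mem x hx =>
    obtain ⟨l, h1, h2, h3, rfl⟩ := hx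
    rw [← List.prod_cons, ← List.map_cons]
    refine prod_mem_chains (by simp [h1]) (by simpa [hg] using h2) ?_
    rw [List.sum_cons, toZ_add, add_comm]
    exact le_sub_iff_add_le.1 h3
  | zero => simp
  | add x y _ _ hx hy => rw [mul_add]; exact add_mem hx hy
  | smul c x _ hx => rw [mul_smul_comm]; exact Submodule.smul_mem _ _ hx

/-- Induction on chains by the first factor. -/
theorem chains_induction {p : ℕ → (Fin n → ℤ) → MonExt K n → Prop}
    (hzero : ∀ t a, p t a 0) (hadd : ∀ t a x y, p t a x → p t a y → p t a (x + y))
    (hsmul : ∀ t a (c : K) x, p t a x → p t a (c • x)) (hone : ∀ a, 0 ≤ a → p 0 a 1)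
    (hmul : ∀ t a, ∀ g ∈ A, ∀ w ∈ chains (K := K) A (a - toZ g) t, p t (a - toZ g) w →
      p (t + 1) a (monGen g * w)) {w : MonExt K n} (hw : w ∈ chains A a t) : p t a w := by
  induction hw using Submodule.span_induction with
  | mem x hx =>
    obtain ⟨l, h1, h2, h3, rfl⟩ := hx
    induction l generalizing t a with
    | nil =>
      obtain rfl : t = 0 := by simpa using h1.symm
      exact hone a (by simpa [toZ_zero] using h3)
    | cons g l ih =>
      obtain ⟨s, rfl⟩ : ∃ s, t = s + 1 := ⟨l.length, by simpa using h1.symm⟩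
      rw [List.map_cons, List.prod_cons]
      have h2' : ∀ g ∈ l, g ∈ A := fun x hx => h2 x (List.mem_cons_of_mem _ hx)
      have h3' : toZ l.sum ≤ a - toZ g := by
        rw [List.sum_cons, toZ_add, add_comm] at h3
        exact le_sub_iff_add_le.2 h3
      have h1' : l.length = s := by simpa using h1
      exact hmul s a g (h2 g List.mem_cons_self) _ (prod_mem_chains h1' h2' h3')
        (ih h1' h2' h3')
  | zero => exact hzero _ _
  | add x y _ _ hx hy => exact hadd _ _ _ _ hx hy
  | smul c x _ hx => exact hsmul _ _ _ _ hx

theorem augDiff_chains_zero {w : MonExt K n} (hw : w ∈ chains A a 0) : augDiff w = 0 := by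
  have : ∀ t a w, w ∈ chains (K := K) A a t → t = 0 → augDiff w = 0 := by
    intro t a w hw
    refine chains_induction (A := A) (p := fun t _ w => t = 0 → augDiff w = 0)
      ?_ ?_ ?_ ?_ ?_ hw
    · simp
    · intro t a x y hx hy h; rw [map_add, hx h, hy h, add_zero]
    · intro t a c x hx h; rw [map_smul, hx h, smul_zero]
    · intro _ _ _; exact augDiff_one
    · intro t _ _ _ _ _ _ h; omega
  exact this 0 a w hw rfl

theorem delGen_chains_of_notMem {u : Fin n →₀ ℕ} (hu : u ∉ A) {w : MonExt K n}
    (hw : w ∈ chains A a t) : delGen u w = 0 := by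
  refine chains_induction (A := A) (p := fun _ _ w => delGen u w = 0) ?_ ?_ ?_ ?_ ?_ hw
  · simp
  · intro t a x y hx hy; rw [map_add, hx, hy, add_zero]
  · intro t a c x hx; rw [map_smul, hx, smul_zero]
  · intro _ _; exact delGen_one u
  · intro t a g hg w _ ih
    rw [delGen_mul, ih, if_neg (by rintro rfl; exact hu hg)]; simp

theorem delGen_chains_zero {u : Fin n →₀ ℕ} {w : MonExt K n} (hw : w ∈ chains A a 0) :
    delGen u w = 0 := by
  have : w ∈ chains (∅ : Set (Fin n →₀ ℕ)) a 0 := by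
    refine Submodule.span_mono ?_ hw
    rintro _ ⟨l, h1, -, h3, rfl⟩
    obtain rfl := List.length_eq_zero_iff.1 h1
    exact ⟨[], rfl, by simp, h3, rfl⟩
  exact delGen_chains_of_notMem (Set.notMem_empty u) this

theorem delGen_mem {u : Fin n →₀ ℕ} {w : MonExt K n} (hw : w ∈ chains A a (t + 1)) :
    delGen u w ∈ chains A (a - toZ u) t := by
  have : ∀ t a w, w ∈ chains (K := K) A a t → ∀ s, t = s + 1 →
      delGen u w ∈ chains A (a - toZ u) s := by
    intro t a w hw
    refine chains_induction (A := A)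
      (p := fun t a w => ∀ s, t = s + 1 → delGen u w ∈ chains A (a - toZ u) s)
      ?_ ?_ ?_ ?_ ?_ hw
    · simp
    · intro t a x y hx hy s h; rw [map_add]; exact add_mem (hx s h) (hy s h)
    · intro t a c x hx s h; rw [map_smul]; exact Submodule.smul_mem _ _ (hx s h)
    · intro _ _ s h; omega
    · intro t a g hg w hw ih s h
      obtain rfl : t = s := by omega
      rw [delGen_mul]
      refine sub_mem ?_ ?_
      · split_ifs with h'
        · rwa [← h']
        · simp
      cases t with
      | zero => rw [delGen_chains_zero hw]; simp
      | succ s =>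
        refine monGen_mul_mem hg ?_
        rw [sub_right_comm]
        exact ih s rfl
  exact this _ a w hw t rfl

/-- Since `u ∧ u = 0`, a nonzero product contains `u` at most once, and anticommutation moves that
factor to the front. -/
theorem exists_eq_add_monGen_mul {u : Fin n →₀ ℕ} {w : MonExt K n}
    (hw : w ∈ chains (insert u B) a (t + 1)) :
    ∃ w₀ ∈ chains B a (t + 1), ∃ w₁ ∈ chains B (a - toZ u) t, w = w₀ + monGen u * w₁ := by
  -- The length is left free for the induction. In length `0` the second part is forced to vanish,
  -- because length `-1` is not available.
  have key : ∀ t a w, w ∈ chains (K := K) (insert u B) a t →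
      ∃ w₀ ∈ chains B a t, ∃ w₁, (∀ s, t = s + 1 → w₁ ∈ chains B (a - toZ u) s) ∧
        (t = 0 → w₁ = 0) ∧ w = w₀ + monGen u * w₁ := by
    intro t a w hw
    refine chains_induction (A := insert u B) (p := fun t a w =>
      ∃ w₀ ∈ chains B a t, ∃ w₁, (∀ s, t = s + 1 → w₁ ∈ chains B (a - toZ u) s) ∧
        (t = 0 → w₁ = 0) ∧ w = w₀ + monGen u * w₁) ?_ ?_ ?_ ?_ ?_ hw
    · intro t a
      exact ⟨0, zero_mem _, 0, by simp, by simp, by simp⟩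
    · rintro t a _ _ ⟨x0, hx0, x1, hx1, hx, rfl⟩ ⟨y0, hy0, y1, hy1, hy, rfl⟩
      refine ⟨x0 + y0, add_mem hx0 hy0, x1 + y1, fun s h => add_mem (hx1 s h) (hy1 s h),
        fun h => by rw [hx h, hy h, add_zero], ?_⟩
      rw [mul_add]; abel
    · rintro t a c _ ⟨x0, hx0, x1, hx1, hx, rfl⟩
      refine ⟨c • x0, Submodule.smul_mem _ _ hx0, c • x1,
        fun s h => Submodule.smul_mem _ _ (hx1 s h), fun h => by rw [hx h, smul_zero], ?_⟩
      rw [smul_add, mul_smul_comm]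
    · intro a ha
      refine ⟨1, prod_mem_chains (l := []) rfl (by simp) (by simpa [toZ_zero] using ha), 0,
        by simp, by simp, by simp⟩
    · rintro t a g hg _ - ⟨x0, hx0, x1, hx1, hx, rfl⟩
      rcases Set.mem_insert_iff.1 hg with rfl | hg
      · refine ⟨0, zero_mem _, x0, ?_, by simp, ?_⟩
        · intro s h
          obtain rfl : t = s := by omega
          exact hx0
        · rw [mul_add, ← mul_assoc, monGen_mul_self]; simp
      · refine ⟨monGen g * x0, monGen_mul_mem hg hx0, -(monGen g * x1), ?_, by simp, ?_⟩
        · intro s h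
          obtain rfl : t = s := by omega
          refine neg_mem ?_
          cases t with
          | zero => rw [hx rfl]; simp
          | succ s =>
            refine monGen_mul_mem hg ?_
            rw [sub_right_comm]
            exact hx1 s rfl
        · rw [mul_add, ← mul_assoc, monGen_anticomm g u]
          simp [mul_assoc]
  obtain ⟨w₀, h₀, w₁, h₁, -, h⟩ := key _ a w hw
  exact ⟨w₀, h₀, w₁, h₁ t rfl, h⟩

/-- The span of the cycles in `chains G c t` with `c ≤ a` and `|c| ≤ t * (d + 1)`. -/
def lowCycles (G : Set (Fin n →₀ ℕ)) (d : ℕ) (a : Fin n → ℤ) (t : ℕ) :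
    Submodule K (MonExt K n) :=
  Submodule.span K {w | ∃ c : Fin n →₀ ℕ, toZ c ≤ a ∧ c.degree ≤ t * (d + 1) ∧
    w ∈ chains G (toZ c) t ∧ augDiff w = 0}

/-! ### Low cycles and the exchange argument -/

variable {d : ℕ}

theorem lowCycles_mono (hab : a ≤ b) :
    (lowCycles G d a t : Submodule K (MonExt K n)) ≤ lowCycles G d b t := by
  refine Submodule.span_mono ?_
  rintro w ⟨c, h1, h2⟩
  exact ⟨c, h1.trans hab, h2⟩

theorem augDiff_lowCycles {w : MonExt K n} (hw : w ∈ lowCycles G d a t) : augDiff w = 0 := by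
  have : lowCycles G d a t ≤ LinearMap.ker (augDiff (K := K) (n := n)) := by
    refine Submodule.span_le.2 ?_
    rintro w ⟨c, -, -, -, h⟩
    exact h
  exact this hw

theorem chains_zero_le_lowCycles (hAG : A ⊆ G) :
    (chains A a 0 : Submodule K (MonExt K n)) ≤ lowCycles G d a 0 := by
  refine Submodule.span_le.2 ?_
  rintro _ ⟨l, h1, h2, h3, rfl⟩
  have hmem : ((l.map monGen).prod : MonExt K n) ∈ chains G (toZ l.sum) 0 :=
    prod_mem_chains h1 (fun g hg => hAG (h2 g hg)) le_rfl
  obtain rfl := List.length_eq_zero_iff.1 h1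
  exact Submodule.subset_span ⟨0, by simpa using h3, by simp, hmem, augDiff_one⟩

/-- If the boundary of a chain `z` of exponent at most `a` has exponent at most `a - e_k`, then `z`
has exponent at most `a - e_k` modulo low cycles. Here `T` is the set of those monomials divisible
by `x_k` which may occur in `z`, and `IH` treats the exponents not involving `x_k`. -/
theorem mem_lowCycles_sup_chains (hd : ∀ g ∈ G, g.degree ≤ d)
    (hx : ∀ g ∈ G, ∀ k, g k ≠ 0 → ∀ j < k, g - Finsupp.single k 1 + Finsupp.single j 1 ∈ G)
    (k : Fin n)
    (IH : ∀ (a : Fin n → ℤ) (t : ℕ), (∀ i, k ≤ i → a i ≤ 0) → ∀ z ∈ chains (K := K) G a t,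
      augDiff z = 0 → z ∈ lowCycles G d a t)
    (T : Finset (Fin n →₀ ℕ)) (hT : ∀ u ∈ T, u ∈ G ∧ u k ≠ 0) :
    ∀ (t : ℕ) (a : Fin n → ℤ) (z : MonExt K n), (∀ i, k < i → a i ≤ 0) →
      ((t * (d + 1) : ℕ) : ℤ) ≤ ∑ i, a i →
      z ∈ chains ({g | g ∈ G ∧ g k = 0} ∪ T) a t →
      (∀ s, t = s + 1 → augDiff z ∈ chains G (a - Pi.single k 1) s) →
      z ∈ lowCycles G d a t ⊔ chains G (a - Pi.single k 1) t := by
  classical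
  induction T using Finset.induction_on with
  | empty =>
    intro t a z ha hsum hz hdz
    cases t with
    | zero =>
      refine Submodule.mem_sup_left (chains_zero_le_lowCycles ?_ hz)
      rintro g (hg | hg)
      · exact hg.1
      · simp at hg
    | succ s =>
      rw [Finset.coe_empty, Set.union_empty] at hz
      rcases le_or_gt (a k) 0 with hk | hk
      -- The bound `a - e_k` has a negative entry, so the boundary is zero and the case of fewer
      -- variables applies.
      · have h0 : augDiff z = 0 := by
          have := hdz s rfl
          rwa [chains_eq_bot (i := k) (by simp; omega), Submodule.mem_bot] at this
        refine Submodule.mem_sup_left (IH a _ ?_ z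
          (chains_mono (fun g hg => hg.1) le_rfl _ hz) h0)
        intro i hi
        rcases hi.eq_or_lt with rfl | hi
        exacts [hk, ha i hi]
      -- No factor of `z` involves `x_k`, so lowering the positive entry `a k` by one loses nothing.
      · refine Submodule.mem_sup_right (Submodule.span_mono ?_ hz)
        rintro _ ⟨l, h1, h2, h3, rfl⟩
        refine ⟨l, h1, fun g hg => (h2 g hg).1, ?_, rfl⟩
        intro i
        by_cases hi : i = k
        · subst hi
          have : l.sum i = 0 := by
            have h2' : ∀ g ∈ l, g i = 0 := fun g hg => (h2 g hg).2
            clear h1 h2 h3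
            induction l with
            | nil => simp
            | cons g l ih =>
              rw [List.sum_cons, Finsupp.add_apply, h2' g List.mem_cons_self,
                ih fun g hg => h2' g (List.mem_cons_of_mem _ hg)]
          simp [toZ, this]
          omega
        · simpa [hi] using h3 i
  | insert u T huT ih =>
    intro t a z ha hsum hz hdz
    have ih := ih fun v hv => hT v (Finset.mem_insert_of_mem hv)
    obtain ⟨huG, huk⟩ := hT u (Finset.mem_insert_self _ _)
    set B : Set (Fin n →₀ ℕ) := {g | g ∈ G ∧ g k = 0} ∪ T with hB
    have hBG : B ⊆ G := by
      rintro g (hg | hg)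
      exacts [hg.1, (hT g (Finset.mem_insert_of_mem hg)).1]
    have huB : u ∉ B := by
      rintro (hg | hg)
      exacts [huk hg.2, huT hg]
    have hins : {g | g ∈ G ∧ g k = 0} ∪ ((insert u T : Finset (Fin n →₀ ℕ)) : Set _)
        = insert u B := by
      rw [Finset.coe_insert, Set.union_insert]
    rw [hins] at hz
    cases t with
    | zero =>
      exact Submodule.mem_sup_left
        (chains_zero_le_lowCycles (Set.insert_subset huG hBG) hz)
    | succ t =>
    obtain ⟨z₀, hz₀, z₁, hz₁, rfl⟩ := exists_eq_add_monGen_mul hz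
    -- The cofactor `z₁` is a contraction of `z`. Contraction anticommutes with the boundary, so
    -- `z₁` inherits the boundary condition with `a - u` in place of `a`.
    have hdel : delGen u (z₀ + monGen u * z₁) = z₁ := by
      rw [map_add, delGen_mul, delGen_chains_of_notMem huB hz₀, delGen_chains_of_notMem huB hz₁]
      simp
    have hdz' := hdz t rfl
    have huk1 : (1 : ℤ) ≤ toZ u k := by
      have : 1 ≤ u k := Nat.one_le_iff_ne_zero.2 huk
      simpa [toZ] using this
    have hau : a - toZ u ≤ a - Pi.single k 1 := by
      intro i
      by_cases hi : i = k
      · subst hi; simp; omega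
      · simpa [hi] using toZ_nonneg u i
    have hdz₁ : ∀ s, t = s + 1 → augDiff z₁ ∈ chains G (a - toZ u - Pi.single k 1) s := by
      rintro s rfl
      rw [← hdel, augDiff_delGen, sub_right_comm]
      exact neg_mem (delGen_mem hdz')
    -- Removing `u` costs at most `d` out of the `d + 1` available for one factor. The surplus `1`
    -- is the room for an extra variable below.
    have hsum₁ : ((t * (d + 1) : ℕ) : ℤ) + 1 ≤ ∑ i, (a - toZ u) i := by
      simp only [Pi.sub_apply, Finset.sum_sub_distrib, sum_toZ]
      have h1 : ((u.degree : ℕ) : ℤ) ≤ d := by exact_mod_cast hd u huG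
      push_cast at hsum ⊢
      linarith
    have hz₁' := ih t (a - toZ u) z₁ (fun i hi => by
      have := toZ_nonneg u i
      have := ha i hi
      simp only [Pi.sub_apply, Pi.zero_apply] at *
      omega) (by omega) hz₁ hdz₁
    have huz₁ : monGen u * z₁ ∈
        lowCycles G d a (t + 1) ⊔ chains G (a - Pi.single k 1) (t + 1) := by
      obtain ⟨y, hy, w, hw, rfl⟩ := Submodule.mem_sup.1 hz₁'
      rw [mul_add]
      refine add_mem ?_ (Submodule.mem_sup_right (monGen_mul_mem huG ?_))
      · clear hz₁' hdz₁ hdel hdz' hdz hz hz₁ hw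
        induction hy using Submodule.span_induction with
        | mem x hx' =>
          obtain ⟨c, hc1, hc2, hc3, hc4⟩ := hx'
          obtain ⟨j, hj⟩ : ∃ j, 1 ≤ a j - toZ u j - toZ c j := by
            by_contra! hcon
            have : ∑ i, (a i - toZ u i - toZ c i) ≤ 0 :=
              Finset.sum_nonpos fun i _ => by have := hcon i; omega
            simp only [Pi.sub_apply] at hsum₁
            rw [Finset.sum_sub_distrib, sum_toZ] at this
            have : (c.degree : ℤ) ≤ ((t * (d + 1) : ℕ) : ℤ) := by exact_mod_cast hc2
            omega
          have hcu : toZ c + toZ u ≤ a := le_sub_iff_add_le.1 hc1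
          -- Beyond `k` the entries of `a` are at most `0`, so there is no room there.
          have hjk : j ≤ k := by
            by_contra! hjk
            have h1 := ha j hjk
            have h2 := toZ_nonneg u j
            have h3 := toZ_nonneg c j
            simp only [Pi.zero_apply] at h2 h3
            omega
          rcases hjk.eq_or_lt with rfl | hjk
          · refine Submodule.mem_sup_right (monGen_mul_mem huG (chains_mono subset_rfl ?_ _ hc3))
            intro i
            by_cases hi : i = j
            · subst hi; simp; omega
            · have := hc1 i
              simpa [hi] using this
          · set u' := u - Finsupp.single k 1 + Finsupp.single j 1 with hu'
            have hu'G : u' ∈ G := hx u huG k huk j hjk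
            have hu'z : toZ u' = toZ u - Pi.single k 1 + Pi.single j 1 := by
              funext i
              simp only [hu', toZ, Finsupp.add_apply, Finsupp.tsub_apply, Pi.add_apply,
                Pi.sub_apply, Finsupp.single_apply, Pi.single_apply]
              by_cases hi : i = k
              · subst hi
                have h1 : 1 ≤ u i := Nat.one_le_iff_ne_zero.2 huk
                simp [hjk.ne]
                omega
              · simp [hi, Ne.symm hi, eq_comm]
            -- The first summand is a cycle because `u - u'` has augmentation zero and `x` is a
            -- cycle. Its exponent `c + u + e_j` has degree at most `t * (d + 1) + d + 1 = (t + 1) *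
            -- (d + 1)`. In the second summand one `x_k` has been traded for an `x_j`, so it fits
            -- under `a - e_k`.
            have hsplit : monGen u * x = (monGen u * x - monGen u' * x) + monGen u' * x := by
              abel
            rw [hsplit]
            refine add_mem (Submodule.mem_sup_left ?_)
              (Submodule.mem_sup_right (monGen_mul_mem hu'G (chains_mono subset_rfl ?_ _ hc3)))
            · refine Submodule.subset_span ⟨c + u + Finsupp.single j 1, ?_, ?_, ?_, ?_⟩
              · intro i
                have h1 := hcu i
                by_cases hi : i = j
                · subst hi
                  simp [toZ] at hj ⊢
                  omega
                · simpa [toZ, hi, Finsupp.single_apply, Ne.symm hi] using h1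
              · simp only [map_add, Finsupp.degree_single]
                have := hd u huG
                nlinarith
              · refine sub_mem (monGen_mul_mem huG (chains_mono subset_rfl ?_ _ hc3))
                  (monGen_mul_mem hu'G (chains_mono subset_rfl ?_ _ hc3))
                · simp only [toZ_add]
                  intro i
                  have := toZ_nonneg (Finsupp.single j 1) i
                  simp at this ⊢
                  omega
                · rw [hu'z]
                  simp only [toZ_add]
                  intro i
                  simp only [toZ, Pi.sub_apply, Pi.add_apply, Finsupp.single_apply,
                    Pi.single_apply, eq_comm (a := j)]
                  split_ifs <;> omega
              · rw [map_sub, augDiff_mul, augDiff_mul, hc4]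
                simp
            · rw [hu'z]
              intro i
              have h1 := hcu i
              by_cases hi : i = j
              · subst hi
                simp [hjk.ne] at hj h1 ⊢
                omega
              · simp [hi] at h1 ⊢
                omega
        | zero => simp
        | add x y _ _ hx hy => rw [mul_add]; exact add_mem hx hy
        | smul c x _ hx => rw [mul_smul_comm]; exact Submodule.smul_mem _ _ hx
      · rw [sub_right_comm]
        exact hw
    refine add_mem (ih (t + 1) a z₀ ha hsum hz₀ ?_) huz₁
    intro s hs
    obtain rfl : t = s := by omega
    -- Each term on the right fits under `a - e_k`: the boundary of `z` by hypothesis, `z₁` because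
    -- `x_k` divides `u`, and the last term by the boundary condition on `z₁`. So the induction
    -- applies to `z₀`, which avoids `u`.
    have h0 : augDiff z₀ = augDiff (z₀ + monGen u * z₁) - z₁ + monGen u * augDiff z₁ := by
      rw [map_add, augDiff_mul]; abel
    rw [h0]
    refine add_mem (sub_mem hdz' (chains_mono hBG hau _ hz₁)) ?_
    cases t with
    | zero => rw [augDiff_chains_zero hz₁]; simp
    | succ s =>
      refine monGen_mul_mem huG ?_
      rw [sub_right_comm]
      exact hdz₁ s rfl

/-- If `G` is a set of monomials of degree at most `d` stable under strongly stable exchanges,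
then the cycles on `G` with `t` factors are generated in degrees at most `t * (d + 1)`. -/
theorem cycle_mem_lowCycles (hd : ∀ g ∈ G, g.degree ≤ d)
    (hx : ∀ g ∈ G, ∀ k, g k ≠ 0 → ∀ j < k, g - Finsupp.single k 1 + Finsupp.single j 1 ∈ G)
    {z : MonExt K n} (hz : z ∈ chains G a t) (hdz : augDiff z = 0) : z ∈ lowCycles G d a t := by
  classical
  -- Outer induction on the number `m` of leading variables that may occur in the exponent bound.
  have key : ∀ m : ℕ, ∀ (a : Fin n → ℤ) (t : ℕ), (∀ i : Fin n, m ≤ (i : ℕ) → a i ≤ 0) →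
      ∀ z ∈ chains (K := K) G a t, augDiff z = 0 → z ∈ lowCycles G d a t := by
    intro m
    induction m with
    | zero =>
      intro a t ha z hz hdz
      by_cases h : ∃ i, a i < 0
      · obtain ⟨i, hi⟩ := h
        rw [chains_eq_bot hi, Submodule.mem_bot] at hz
        rw [hz]; exact zero_mem _
      · push Not at h
        obtain rfl : a = 0 := funext fun i => le_antisymm (ha i (Nat.zero_le _)) (h i)
        exact Submodule.subset_span ⟨0, by rw [toZ_zero], by simp, by rwa [toZ_zero], hdz⟩
    | succ m ihm =>
      rcases le_or_gt n m with hm | hm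
      · intro a t _
        exact ihm a t fun i hi => absurd i.2 (by omega)
      let k : Fin n := ⟨m, hm⟩
      -- The degree bound makes the set of monomials divisible by `x_k` finite, so all of them can
      -- be split off one by one.
      have hfin : {g : Fin n →₀ ℕ | g ∈ G ∧ g k ≠ 0}.Finite :=
        (Finsupp.finite_of_degree_le (σ := Fin n) d).subset fun g hg => hd g hg.1
      have hstep := mem_lowCycles_sup_chains (K := K) hd hx k
        (fun a t ha => ihm a t fun i hi => ha i hi) hfin.toFinset
        (fun u hu => by simpa using hu)
      have hunion : {g | g ∈ G ∧ g k = 0} ∪ (hfin.toFinset : Set (Fin n →₀ ℕ)) = G := by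
        ext g
        simp only [Set.Finite.coe_toFinset, Set.mem_union, Set.mem_ofPred_eq]
        tauto
      rw [hunion] at hstep
      -- Inner induction on `|a|`: above the degree bound a cycle is moved to `a - e_k` modulo low
      -- cycles, and the remainder is again a cycle. Below the bound `a` itself is the witness.
      have : ∀ (N : ℕ) (a : Fin n → ℤ) (t : ℕ), ∑ i, a i < N →
          (∀ i : Fin n, m + 1 ≤ (i : ℕ) → a i ≤ 0) →
          ∀ z ∈ chains (K := K) G a t, augDiff z = 0 → z ∈ lowCycles G d a t := by
        intro N
        induction N with
        | zero =>
          intro a t hN ha z hz hdz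
          obtain ⟨i, hi⟩ : ∃ i, a i < 0 := by
            by_contra! h
            exact absurd (Finset.sum_nonneg fun i _ => h i) (by simpa using hN)
          rw [chains_eq_bot hi, Submodule.mem_bot] at hz
          rw [hz]; exact zero_mem _
        | succ N ihN =>
          intro a t hN ha z hz hdz
          by_cases h : ∃ i, a i < 0
          · obtain ⟨i, hi⟩ := h
            rw [chains_eq_bot hi, Submodule.mem_bot] at hz
            rw [hz]; exact zero_mem _
          push Not at h
          rcases le_or_gt (∑ i, a i) ((t * (d + 1) : ℕ) : ℤ) with hle | hgt
          · let c : Fin n →₀ ℕ := Finsupp.equivFunOnFinite.symm fun i => (a i).toNat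
            have hc : toZ c = a := by
              funext i
              simp [toZ, c, h i]
            refine Submodule.subset_span ⟨c, hc.le, ?_, by rwa [hc], hdz⟩
            rw [← hc, sum_toZ] at hle
            exact_mod_cast hle
          · obtain ⟨y, hy, w, hw, rfl⟩ := Submodule.mem_sup.1 (hstep t a z
              (fun i hi => ha i hi) hgt.le hz fun s _ => by rw [hdz]; exact zero_mem _)
            have hle : a - Pi.single k 1 ≤ a :=
              sub_le_self _ (Pi.single_nonneg.2 zero_le_one)
            refine add_mem hy (lowCycles_mono hle (ihN _ t ?_ ?_ w hw ?_))
            · simp only [Pi.sub_apply, Finset.sum_sub_distrib, Finset.sum_pi_single',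
                Finset.mem_univ, if_true]
              push_cast at hN
              omega
            · intro i hi
              exact (hle i).trans (ha i hi)
            · rw [map_add, augDiff_lowCycles hy, zero_add] at hdz
              exact hdz
      intro a t ha
      have hN := Int.self_le_toNat (∑ i, a i)
      exact this ((∑ i, a i).toNat + 1) a t (by push_cast; omega) ha
  exact key n a t (fun i hi => absurd i.2 (by omega)) z hz hdz

end

section

/-! ### Lifting monomials along a minimal presentation -/

theorem mem_ideal_of_mem_support {I : Ideal (MvPolynomial (Fin n) K)} (hI : IsStronglyStable I)
    {p : MvPolynomial (Fin n) K} (hp : p ∈ I) {g : Fin n →₀ ℕ} (hg : g ∈ p.support) :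
    monomial g (1 : K) ∈ I := by
  obtain ⟨A, rfl⟩ := hI.isMonomial
  rw [mem_ideal_span_monomial_image] at hp ⊢
  intro x hx
  obtain rfl : g = x := by
    classical
    rw [mem_support_iff, coeff_monomial] at hx
    by_contra h
    simp [h] at hx
  exact hp g hg

theorem constantCoeff_eq_zero_of_mem_smul_top {r : ℕ} {v : Fin r → MvPolynomial (Fin n) K}
    (hv : v ∈ idealOfVars (Fin n) K •
      (⊤ : Submodule (MvPolynomial (Fin n) K) (Fin r → MvPolynomial (Fin n) K)))
    (l : Fin r) : constantCoeff (v l) = 0 := by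
  have hle : idealOfVars (Fin n) K ≤ RingHom.ker (constantCoeff (σ := Fin n) (R := K)) := by
    rw [Ideal.span_le]
    rintro _ ⟨i, rfl⟩
    simp [RingHom.mem_ker]
  refine Submodule.smul_induction_on hv ?_ ?_
  · intro p hp w _
    have h0 : constantCoeff p = 0 := hle hp
    simp [h0]
  · intro x y hx hy
    simp [hx, hy]

/-- `freeProj` as a linear map. -/
def freeProjHom {b : ℕ} (e : Fin b → ℕ) (q : ℕ) :
    (Fin b → MvPolynomial (Fin n) K) →ₗ[K] (Fin b → MvPolynomial (Fin n) K) where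
  toFun := freeProj e q
  map_add' v w := by
    funext l; ext c
    simp only [coeff_freeProj, Pi.add_apply, coeff_add]
    split_ifs <;> simp
  map_smul' a v := by
    funext l; ext c
    simp only [coeff_freeProj, Pi.smul_apply, coeff_smul, RingHom.id_apply]
    split_ifs <;> simp

theorem freeProj_single {b : ℕ} (e : Fin b → ℕ) (q : ℕ) (l : Fin b) (c : Fin n →₀ ℕ) (x : K) :
    freeProj e q (Pi.single l (monomial c x)) =
      if c.degree + e l = q then Pi.single l (monomial c x) else 0 := by
  classical
  funext l'
  ext c'
  rw [coeff_freeProj]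
  by_cases hl : l' = l
  · subst hl
    by_cases hc : c = c'
    · subst hc
      split_ifs <;> simp
    · split_ifs <;> simp [coeff_monomial, hc]
  · split_ifs <;> simp [hl]

theorem map_eq_sum_mul {b : ℕ}
    (φ : (Fin b → MvPolynomial (Fin n) K) →ₗ[MvPolynomial (Fin n) K] MvPolynomial (Fin n) K)
    (v : Fin b → MvPolynomial (Fin n) K) : φ v = ∑ k, v k * φ (Pi.single k 1) := by
  conv_lhs => rw [pi_eq_sum_univ' v]
  simp only [map_sum, map_smul, smul_eq_mul]

/-- A graded map to `S` commutes with the projections onto the homogeneous components. -/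
theorem map_freeProj {b : ℕ} (e : Fin b → ℕ)
    (φ : (Fin b → MvPolynomial (Fin n) K) →ₗ[MvPolynomial (Fin n) K] MvPolynomial (Fin n) K)
    (hφ : ∀ k, (φ (Pi.single k 1)).IsHomogeneous (e k)) (q : ℕ)
    (v : Fin b → MvPolynomial (Fin n) K) :
    φ (freeProj e q v) = homogeneousComponent q (φ v) := by
  let f₁ : (Fin b → MvPolynomial (Fin n) K) →ₗ[K] MvPolynomial (Fin n) K :=
    (φ.restrictScalars K).comp (freeProjHom e q)
  let f₂ : (Fin b → MvPolynomial (Fin n) K) →ₗ[K] MvPolynomial (Fin n) K :=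
    (homogeneousComponent q).comp (φ.restrictScalars K)
  have hsingle : ∀ (l : Fin b) (p : MvPolynomial (Fin n) K),
      f₁ (Pi.single l p) = f₂ (Pi.single l p) := by
    intro l p
    induction p using MvPolynomial.induction_on' with
    | monomial c x =>
      have hhom : (φ (Pi.single l (monomial c x))).IsHomogeneous (c.degree + e l) := by
        have hl : (Pi.single l (monomial c x) : Fin b → MvPolynomial (Fin n) K) =
            monomial c x • Pi.single l 1 := by
          rw [← Pi.single_smul, smul_eq_mul, mul_one]
        rw [hl, map_smul, smul_eq_mul]
        exact (isHomogeneous_monomial x rfl).mul (hφ l)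
      change φ (freeProj e q _) = homogeneousComponent q (φ _)
      rw [freeProj_single, homogeneousComponent_of_mem hhom]
      by_cases h : c.degree + e l = q
      · rw [if_pos h, if_pos h.symm]
      · rw [if_neg h, if_neg (Ne.symm h), map_zero]
    | add p p' hp hp' => rw [Pi.single_add, map_add, map_add, hp, hp']
  have : f₁ v = f₂ v := by
    have hv : v = ∑ l, Pi.single l (v l) := (Finset.univ_sum_single v).symm
    rw [hv, map_sum, map_sum]
    exact Finset.sum_congr rfl fun l _ => hsingle l _
  exact this

namespace MinimalPresentation

variable {I : Ideal (MvPolynomial (Fin n) K)} (P : MinimalPresentation I)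

theorem φ_apply (v : Fin P.rank → MvPolynomial (Fin n) K) :
    P.φ v = ∑ k, v k * P.φ (Pi.single k 1) :=
  map_eq_sum_mul P.φ v

theorem φ_mem (v : Fin P.rank → MvPolynomial (Fin n) K) : P.φ v ∈ I :=
  P.range_eq.le ⟨v, rfl⟩

theorem φ_freeProj (q : ℕ) (v : Fin P.rank → MvPolynomial (Fin n) K) :
    P.φ (freeProj P.deg q v) = homogeneousComponent q (P.φ v) :=
  map_freeProj P.deg P.φ P.graded q v

/-- The map on vectors of constants induced by `φ`. -/
def constMap : (Fin P.rank → K) →ₗ[K] (Fin P.rank → MvPolynomial (Fin n) K) where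
  toFun c := fun l => C (c l)
  map_add' c c' := by funext l; simp
  map_smul' a c := by funext l; simp [smul_eq_C_mul]

/-- By minimality a vector in `ker φ` has entries in the maximal ideal, and a constant there is
zero. -/
theorem ker_φ_constMap :
    LinearMap.ker ((P.φ.restrictScalars K).comp P.constMap) = ⊥ := by
  rw [LinearMap.ker_eq_bot']
  intro c hc
  have hmem : P.constMap c ∈ LinearMap.ker P.φ := hc
  funext l
  have := constantCoeff_eq_zero_of_mem_smul_top (P.minimal hmem) l
  simpa [constMap] using this

/-- Homogeneous lifts of the monomials of `I` such that the induced lift of `φ (e_k)` is `e_k`. -/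
theorem exists_monomial_lift :
    ∃ v : (Fin n →₀ ℕ) → (Fin P.rank → MvPolynomial (Fin n) K),
      (∀ g, v g ∈ freeComponent K n P.deg g.degree) ∧
      (∀ g, monomial g (1 : K) ∈ I → P.φ (v g) = monomial g 1) ∧
      ∀ k, ∑ g ∈ (P.φ (Pi.single k 1)).support,
        (P.φ (Pi.single k 1)).coeff g • v g = Pi.single k 1 := by
  classical
  let ψ := (P.φ.restrictScalars K).comp P.constMap
  obtain ⟨L, hL⟩ := LinearMap.exists_leftInverse_of_injective ψ P.ker_φ_constMap
  obtain ⟨s₀, hs₀⟩ := LinearMap.exists_rightInverse_of_surjective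
    (P.φ.restrictScalars K).rangeRestrict (LinearMap.range_rangeRestrict _)
  obtain ⟨s, hs⟩ := LinearMap.exists_extend s₀
  have hφs : ∀ p ∈ I, P.φ (s p) = p := by
    intro p hp
    rw [← P.range_eq] at hp
    obtain ⟨w, rfl⟩ := hp
    have h1 : s (P.φ w) = s₀ ⟨P.φ w, w, rfl⟩ := by
      rw [← hs]; rfl
    have h2 := congrArg Subtype.val (LinearMap.congr_fun hs₀ ⟨P.φ w, w, rfl⟩)
    rw [h1]
    exact h2
  -- The section `s` is corrected so that on the `K`-span of the `φ (e_k)`, where `ψ ∘ L` is the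
  -- identity, the lift is the constant vector. Elsewhere in `I` the two summands still add up to a
  -- lift.
  let w : MvPolynomial (Fin n) K →ₗ[K] (Fin P.rank → MvPolynomial (Fin n) K) :=
    s.comp (LinearMap.id - ψ.comp L) + P.constMap.comp L
  have hw : ∀ p, w p = s (p - ψ (L p)) + P.constMap (L p) := fun p => rfl
  have hφw : ∀ p ∈ I, P.φ (w p) = p := by
    intro p hp
    have hmem : p - ψ (L p) ∈ I := sub_mem hp (P.φ_mem _)
    rw [hw, map_add, hφs _ hmem]
    exact sub_add_cancel p _
  have hwk : ∀ k, w (P.φ (Pi.single k 1)) = Pi.single k 1 := by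
    intro k
    have hk : P.constMap (Pi.single k 1) = Pi.single k 1 := by
      funext l
      by_cases h : l = k
      · subst h; simp [constMap]
      · simp [constMap, h]
    have hψ : P.φ (Pi.single k 1) = ψ (Pi.single k 1) := by
      rw [← hk]; rfl
    have hLψ : L (ψ (Pi.single k 1)) = Pi.single k 1 := LinearMap.congr_fun hL _
    rw [hψ, hw, hLψ, sub_self, map_zero, zero_add, hk]
  refine ⟨fun g => freeProj P.deg g.degree (w (monomial g 1)), fun g => freeProj_mem _ _ _,
    ?_, ?_⟩
  · intro g hg
    rw [φ_freeProj, hφw _ hg, homogeneousComponent_of_mem (isHomogeneous_monomial 1 rfl),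
      if_pos rfl]
  · intro k
    set p := P.φ (Pi.single k 1) with hp
    have hdeg : ∀ g ∈ p.support, g.degree = P.deg k := by
      intro g hg
      have := P.graded k (mem_support_iff.1 hg)
      rwa [Finsupp.degree_eq_weight_one]
    calc ∑ g ∈ p.support, p.coeff g • freeProj P.deg g.degree (w (monomial g 1))
        = ∑ g ∈ p.support, freeProjHom P.deg (P.deg k) (w (monomial g (p.coeff g))) := by
          refine Finset.sum_congr rfl fun g hg => ?_
          rw [hdeg g hg]
          change _ • freeProjHom P.deg (P.deg k) _ = _
          rw [← map_smul, ← map_smul, smul_monomial, smul_eq_mul, mul_one]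
      _ = freeProjHom P.deg (P.deg k) (w p) := by
          rw [← map_sum, ← map_sum, support_sum_monomial_coeff]
      _ = Pi.single k 1 := by
          rw [hp, hwk]
          change freeProj _ _ _ = _
          have := freeProj_single P.deg (P.deg k) k (0 : Fin n →₀ ℕ) (1 : K)
          simpa using this

end MinimalPresentation

/-! ### Square-zero elements of monoid algebras over exterior algebras -/

section squareZero

variable {R V M : Type*} [CommRing R] [AddCommGroup V] [Module R V] [AddCommMonoid M]

/-- The additive span of the elements `single m (ι v)`. -/
def iotaSpan (R V M : Type*) [CommRing R] [AddCommGroup V] [Module R V] [AddCommMonoid M] :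
    AddSubmonoid (AddMonoidAlgebra (ExteriorAlgebra R V) M) :=
  AddSubmonoid.closure {x | ∃ (m : M) (v : V), x = AddMonoidAlgebra.single m (ExteriorAlgebra.ι R v)}

theorem single_mem_iotaSpan (m : M) (v : V) :
    AddMonoidAlgebra.single m (ExteriorAlgebra.ι R v) ∈ iotaSpan R V M :=
  AddSubmonoid.subset_closure ⟨m, v, rfl⟩

theorem iotaSpan_anticomm {x y : AddMonoidAlgebra (ExteriorAlgebra R V) M}
    (hx : x ∈ iotaSpan R V M) (hy : y ∈ iotaSpan R V M) : x * y + y * x = 0 := by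
  induction hx using AddSubmonoid.closure_induction with
  | mem x hx =>
    obtain ⟨m, v, rfl⟩ := hx
    induction hy using AddSubmonoid.closure_induction with
    | mem y hy =>
      obtain ⟨m', v', rfl⟩ := hy
      rw [AddMonoidAlgebra.single_mul_single, AddMonoidAlgebra.single_mul_single, add_comm m' m,
        ← AddMonoidAlgebra.single_add, ExteriorAlgebra.ι_add_mul_swap, AddMonoidAlgebra.single_zero]
    | zero => simp
    | add y y' _ _ h h' =>
      rw [mul_add, add_mul, add_add_add_comm, h, h', add_zero]
  | zero => simp
  | add x x' _ _ h h' =>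
    rw [mul_add, add_mul, add_add_add_comm, h, h', add_zero]

/-- Squares vanish on the spanning elements and cross terms cancel in pairs, which also covers
characteristic two. This is the condition required by the universal property of the exterior
algebra. -/
theorem iotaSpan_mul_self {x : AddMonoidAlgebra (ExteriorAlgebra R V) M}
    (hx : x ∈ iotaSpan R V M) : x * x = 0 := by
  induction hx using AddSubmonoid.closure_induction with
  | mem x hx =>
    obtain ⟨m, v, rfl⟩ := hx
    rw [AddMonoidAlgebra.single_mul_single, ExteriorAlgebra.ι_sq_zero,
      AddMonoidAlgebra.single_zero]
  | zero => simp
  | add x y hx hy h h' =>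
    have := iotaSpan_anticomm hx hy
    calc (x + y) * (x + y) = x * x + y * y + (x * y + y * x) := by noncomm_ring
      _ = 0 := by rw [h, h', this]; simp

end squareZero

end

section

/-! ### Dehomogenization -/

/-- The monoid algebra carrying the multihomogeneous components of dehomogenized chains. -/
abbrev MonExtAlg (K : Type*) [Field K] (n : ℕ) := AddMonoidAlgebra (MonExt K n) (Fin n →₀ ℕ)

/-- The ring homomorphism `x^r ↦ single r 1`. -/
def polyHom : MvPolynomial (Fin n) K →+* MonExtAlg K n :=
  AddMonoidAlgebra.mapRingHom (Fin n →₀ ℕ) (algebraMap K (MonExt K n))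

theorem polyHom_monomial (r : Fin n →₀ ℕ) (c : K) :
    polyHom (monomial r c) = AddMonoidAlgebra.single r (algebraMap K (MonExt K n) c) :=
  AddMonoidAlgebra.mapRingHom_single _ _ _

theorem polyHom_commutes (p : MvPolynomial (Fin n) K) (x : MonExtAlg K n) :
    polyHom p * x = x * polyHom p := by
  induction p using MvPolynomial.induction_on' with
  | monomial r c =>
    rw [polyHom_monomial]
    induction x using AddMonoidAlgebra.induction_linear with
    | zero => simp
    | add x y hx hy => rw [mul_add, add_mul, hx, hy]
    | single m w =>
      rw [AddMonoidAlgebra.single_mul_single, AddMonoidAlgebra.single_mul_single, add_comm m r,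
        Algebra.commutes]
  | add p q hp hq => rw [map_add, add_mul, mul_add, hp, hq]

/-- The image of `polyHom` is central, so an exterior algebra over the polynomial ring can be mapped
here by its universal property. -/
instance instAlgebraMonExtAlg : Algebra (MvPolynomial (Fin n) K) (MonExtAlg K n) :=
  polyHom.toAlgebra' polyHom_commutes

theorem monExtAlg_smul_def (p : MvPolynomial (Fin n) K) (x : MonExtAlg K n) :
    p • x = polyHom p * x := rfl

theorem polyHom_mul_mem_iotaSpan (p : MvPolynomial (Fin n) K) {x : MonExtAlg K n}
    (hx : x ∈ iotaSpan K ((Fin n →₀ ℕ) →₀ K) (Fin n →₀ ℕ)) :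
    polyHom p * x ∈ iotaSpan K ((Fin n →₀ ℕ) →₀ K) (Fin n →₀ ℕ) := by
  induction p using MvPolynomial.induction_on' with
  | monomial r c =>
    rw [polyHom_monomial]
    induction hx using AddSubmonoid.closure_induction with
    | mem x hx =>
      obtain ⟨m, v, rfl⟩ := hx
      rw [AddMonoidAlgebra.single_mul_single, ← Algebra.smul_def, ← map_smul]
      exact single_mem_iotaSpan _ _
    | zero => simp
    | add x y _ _ hx hy => rw [mul_add]; exact add_mem hx hy
  | add p q hp hq => rw [map_add, add_mul]; exact add_mem hp hq

/-- The differential `augDiff`, applied to coefficients. -/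
def coeffDiff : MonExtAlg K n →+ MonExtAlg K n :=
  (AddMonoidAlgebra.coeffAddEquiv.symm.toAddMonoidHom.comp
    (Finsupp.mapRange.addMonoidHom (augDiff (K := K) (n := n)).toAddMonoidHom)).comp
    AddMonoidAlgebra.coeffAddEquiv.toAddMonoidHom

theorem coeff_coeffDiff (x : MonExtAlg K n) (a : Fin n →₀ ℕ) :
    (coeffDiff x).coeff a = augDiff (x.coeff a) := rfl

theorem coeffDiff_single (m : Fin n →₀ ℕ) (w : MonExt K n) :
    coeffDiff (AddMonoidAlgebra.single m w) = AddMonoidAlgebra.single m (augDiff w) := by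
  classical
  ext a
  rw [coeff_coeffDiff, AddMonoidAlgebra.coeff_single, AddMonoidAlgebra.coeff_single,
    Finsupp.single_apply, Finsupp.single_apply]
  split_ifs <;> simp

theorem coeffDiff_polyHom_mul (p : MvPolynomial (Fin n) K) (x : MonExtAlg K n) :
    coeffDiff (polyHom p * x) = polyHom p * coeffDiff x := by
  induction p using MvPolynomial.induction_on' with
  | monomial r c =>
    rw [polyHom_monomial]
    induction x using AddMonoidAlgebra.induction_linear with
    | zero => simp
    | add x y hx hy => rw [mul_add, map_add, map_add, mul_add, hx, hy]
    | single m w =>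
      rw [AddMonoidAlgebra.single_mul_single, coeffDiff_single, coeffDiff_single,
        AddMonoidAlgebra.single_mul_single, ← Algebra.smul_def, ← Algebra.smul_def, map_smul]
  | add p q hp hq => rw [map_add, add_mul, add_mul, map_add, hp, hq]

theorem coeffDiff_single_monGen_mul (g : Fin n →₀ ℕ) (x : MonExtAlg K n) :
    coeffDiff (AddMonoidAlgebra.single g (monGen g) * x) =
      polyHom (monomial g 1) * x - AddMonoidAlgebra.single g (monGen g) * coeffDiff x := by
  rw [polyHom_monomial, map_one]
  induction x using AddMonoidAlgebra.induction_linear with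
  | zero => simp
  | add x y hx hy => rw [mul_add, map_add, map_add, mul_add, mul_add, hx, hy]; abel
  | single m w =>
    rw [AddMonoidAlgebra.single_mul_single, coeffDiff_single, coeffDiff_single,
      AddMonoidAlgebra.single_mul_single, AddMonoidAlgebra.single_mul_single, one_mul,
      augDiff_mul, sub_eq_add_neg, AddMonoidAlgebra.single_add, AddMonoidAlgebra.single_neg,
      sub_eq_add_neg]

/-- The elements of `MonExtAlg K n` whose coefficient at `a` is a chain of exponent at most `a`. -/
def chainAlg (A : Set (Fin n →₀ ℕ)) (t : ℕ) : AddSubmonoid (MonExtAlg K n) :=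
  AddSubmonoid.closure {x | ∃ (a : Fin n →₀ ℕ) (w : MonExt K n), w ∈ chains A (toZ a) t ∧
    x = AddMonoidAlgebra.single a w}

/-! ### Chains recorded by multidegree -/

variable {A : Set (Fin n →₀ ℕ)} {t : ℕ}

theorem coeff_mem_of_mem_chainAlg {x : MonExtAlg K n} (hx : x ∈ chainAlg A t)
    (a : Fin n →₀ ℕ) : x.coeff a ∈ chains A (toZ a) t := by
  classical
  induction hx using AddSubmonoid.closure_induction with
  | mem x hx =>
    obtain ⟨b, w, hw, rfl⟩ := hx
    rw [AddMonoidAlgebra.coeff_single, Finsupp.single_apply]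
    split_ifs with h
    · rwa [← h]
    · exact zero_mem _
  | zero => exact zero_mem _
  | add x y _ _ hx hy => exact add_mem hx hy

theorem polyHom_mul_mem_chainAlg (p : MvPolynomial (Fin n) K) {x : MonExtAlg K n}
    (hx : x ∈ chainAlg A t) : polyHom p * x ∈ chainAlg A t := by
  induction p using MvPolynomial.induction_on' with
  | monomial r c =>
    rw [polyHom_monomial]
    induction hx using AddSubmonoid.closure_induction with
    | mem x hx =>
      obtain ⟨b, w, hw, rfl⟩ := hx
      rw [AddMonoidAlgebra.single_mul_single, ← Algebra.smul_def]
      refine AddSubmonoid.subset_closure ⟨_, _, Submodule.smul_mem _ _ ?_, rfl⟩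
      refine chains_mono subset_rfl ?_ _ hw
      rw [toZ_le_toZ]
      exact le_add_self
    | zero => simp
    | add x y _ _ hx hy => rw [mul_add]; exact add_mem hx hy
  | add p q hp hq => rw [map_add, add_mul]; exact add_mem hp hq

theorem single_monGen_mul_mem_chainAlg {g : Fin n →₀ ℕ} (hg : g ∈ A) {x : MonExtAlg K n}
    (hx : x ∈ chainAlg A t) :
    AddMonoidAlgebra.single g (monGen g) * x ∈ chainAlg A (t + 1) := by
  induction hx using AddSubmonoid.closure_induction with
  | mem x hx =>
    obtain ⟨b, w, hw, rfl⟩ := hx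
    rw [AddMonoidAlgebra.single_mul_single]
    refine AddSubmonoid.subset_closure ⟨_, _, monGen_mul_mem hg ?_, rfl⟩
    rwa [toZ_add, add_sub_cancel_left]
  | zero => simp
  | add x y _ _ hx hy => rw [mul_add]; exact add_mem hx hy

/-- Induction on chains of exponent at most a monomial. -/
theorem chains_induction_monomial {p : ℕ → (Fin n →₀ ℕ) → MonExt K n → Prop}
    (hzero : ∀ t c, p t c 0) (hadd : ∀ t c x y, p t c x → p t c y → p t c (x + y))
    (hsmul : ∀ t c (k : K) x, p t c x → p t c (k • x)) (hone : ∀ c, p 0 c 1)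
    (hmul : ∀ t c, ∀ g ∈ A, ∀ w ∈ chains (K := K) A (toZ c) t, p t c w →
      p (t + 1) (g + c) (monGen g * w)) {w : MonExt K n} {c : Fin n →₀ ℕ}
    (hw : w ∈ chains A (toZ c) t) : p t c w := by
  refine chains_induction (A := A) (p := fun t a w => ∀ c, toZ c = a → p t c w)
    ?_ ?_ ?_ ?_ ?_ hw c rfl
  · intro t _ c _; exact hzero t c
  · intro t a x y hx hy c hc; exact hadd _ _ _ _ (hx c hc) (hy c hc)
  · intro t a k x hx c hc; exact hsmul _ _ _ _ (hx c hc)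
  · intro _ _ c _; exact hone c
  · rintro t _ g hg w hw ih c rfl
    by_cases hgc : g ≤ c
    · obtain ⟨b, rfl⟩ := exists_add_of_le hgc
      rw [toZ_add, add_sub_cancel_left] at hw ih
      exact hmul t b g hg w hw (ih b rfl)
    · obtain ⟨i, hi⟩ : ∃ i, c i < g i := by
        by_contra! h
        exact hgc h
      rw [chains_eq_bot (i := i) (by simp [toZ]; omega), Submodule.mem_bot] at hw
      rw [hw, mul_zero]
      exact hzero _ _

end

section

namespace MinimalPresentation

variable {I : Ideal (MvPolynomial (Fin n) K)} (P : MinimalPresentation I)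

/-! ### From the Koszul complex to dehomogenized chains -/

/-- The dehomogenized image of a basis vector. -/
def dehomBasis (k : Fin P.rank) : MonExtAlg K n :=
  ∑ g ∈ (P.φ (Pi.single k 1)).support,
    polyHom (C ((P.φ (Pi.single k 1)).coeff g)) * AddMonoidAlgebra.single g (monGen g)

/-- The dehomogenization of vectors. -/
def dehomVec : (Fin P.rank → MvPolynomial (Fin n) K) →ₗ[MvPolynomial (Fin n) K] MonExtAlg K n :=
  Fintype.linearCombination (MvPolynomial (Fin n) K) P.dehomBasis

theorem dehomVec_apply (v : Fin P.rank → MvPolynomial (Fin n) K) :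
    P.dehomVec v = ∑ k, polyHom (v k) * P.dehomBasis k := rfl

theorem dehomVec_mem_iotaSpan (v : Fin P.rank → MvPolynomial (Fin n) K) :
    P.dehomVec v ∈ iotaSpan K ((Fin n →₀ ℕ) →₀ K) (Fin n →₀ ℕ) := by
  rw [dehomVec_apply]
  exact sum_mem fun k _ => polyHom_mul_mem_iotaSpan _
    (sum_mem fun g _ => polyHom_mul_mem_iotaSpan _ (single_mem_iotaSpan _ _))

/-- The dehomogenization of the Koszul complex. -/
def dehom : ExteriorAlgebra (MvPolynomial (Fin n) K) (Fin P.rank → MvPolynomial (Fin n) K)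
    →ₐ[MvPolynomial (Fin n) K] MonExtAlg K n :=
  ExteriorAlgebra.lift _ ⟨P.dehomVec, fun v => iotaSpan_mul_self (P.dehomVec_mem_iotaSpan v)⟩

theorem dehom_ι_mul (v : Fin P.rank → MvPolynomial (Fin n) K)
    (z : ExteriorAlgebra (MvPolynomial (Fin n) K) (Fin P.rank → MvPolynomial (Fin n) K)) :
    P.dehom (ExteriorAlgebra.ι _ v * z) = P.dehomVec v * P.dehom z := by
  rw [map_mul, dehom, ExteriorAlgebra.lift_ι_apply]

/-- This is the Leibniz rule characterizing the Koszul differential. It follows from the rule for a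
single monomial, since the monomials of `φ (e_k)` are weighted by its coefficients. -/
theorem coeffDiff_dehomVec_mul (v : Fin P.rank → MvPolynomial (Fin n) K) (x : MonExtAlg K n) :
    coeffDiff (P.dehomVec v * x) = polyHom (P.φ v) * x - P.dehomVec v * coeffDiff x := by
  have hbasis : ∀ k, coeffDiff (P.dehomBasis k * x) =
      polyHom (P.φ (Pi.single k 1)) * x - P.dehomBasis k * coeffDiff x := by
    intro k
    have hφ : polyHom (P.φ (Pi.single k 1)) = ∑ g ∈ (P.φ (Pi.single k 1)).support,
        polyHom (C ((P.φ (Pi.single k 1)).coeff g)) * polyHom (K := K) (monomial g 1) := by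
      conv_lhs => rw [← support_sum_monomial_coeff (P.φ (Pi.single k 1)), map_sum]
      refine Finset.sum_congr rfl fun g _ => ?_
      rw [← map_mul, C_mul_monomial, mul_one]
    rw [hφ, dehomBasis, Finset.sum_mul, Finset.sum_mul, Finset.sum_mul, map_sum,
      ← Finset.sum_sub_distrib]
    refine Finset.sum_congr rfl fun g _ => ?_
    rw [mul_assoc, coeffDiff_polyHom_mul, coeffDiff_single_monGen_mul, mul_sub, mul_assoc,
      mul_assoc]
  rw [P.φ_apply v, map_sum, dehomVec_apply, Finset.sum_mul, Finset.sum_mul, Finset.sum_mul,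
    map_sum, ← Finset.sum_sub_distrib]
  refine Finset.sum_congr rfl fun k _ => ?_
  rw [mul_assoc, coeffDiff_polyHom_mul, hbasis, mul_sub, map_mul, mul_assoc, mul_assoc]

theorem koszulDifferential_ι_mul (v : Fin P.rank → MvPolynomial (Fin n) K)
    (z : ExteriorAlgebra (MvPolynomial (Fin n) K) (Fin P.rank → MvPolynomial (Fin n) K)) :
    P.koszulDifferential (ExteriorAlgebra.ι _ v * z) =
      P.φ v • z - ExteriorAlgebra.ι _ v * P.koszulDifferential z :=
  CliffordAlgebra.contractLeft_ι_mul (Q := 0) _ _ _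

theorem koszulDifferential_one : P.koszulDifferential 1 = 0 :=
  CliffordAlgebra.contractLeft_one (Q := 0) _

theorem coeffDiff_dehom
    (z : ExteriorAlgebra (MvPolynomial (Fin n) K) (Fin P.rank → MvPolynomial (Fin n) K)) :
    coeffDiff (P.dehom z) = P.dehom (P.koszulDifferential z) := by
  induction z using CliffordAlgebra.left_induction with
  | algebraMap p =>
    have h1 : (algebraMap (MvPolynomial (Fin n) K) (CliffordAlgebra
        (0 : QuadraticForm (MvPolynomial (Fin n) K) (Fin P.rank → MvPolynomial (Fin n) K))) p) =
        p • (1 : ExteriorAlgebra (MvPolynomial (Fin n) K)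
          (Fin P.rank → MvPolynomial (Fin n) K)) := Algebra.algebraMap_eq_smul_one p
    rw [h1, map_smul P.koszulDifferential, koszulDifferential_one, smul_zero, map_zero,
      map_smul P.dehom, map_one, monExtAlg_smul_def, coeffDiff_polyHom_mul,
      AddMonoidAlgebra.one_def, coeffDiff_single, augDiff_one]
    simp
  | add x y hx hy => rw [map_add, map_add, map_add, map_add, hx, hy]
  | ι_mul z v hz =>
    refine (congrArg coeffDiff (P.dehom_ι_mul v z)).trans
      (Eq.trans ?_ (congrArg P.dehom (P.koszulDifferential_ι_mul v z)).symm)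
    rw [coeffDiff_dehomVec_mul, map_sub, dehom_ι_mul, map_smul, monExtAlg_smul_def, hz]

/-! ### Homogenization -/

variable {A : Set (Fin n →₀ ℕ)} {t : ℕ}

/-- Sum up the coefficients, after multiplying the one at `b` by `x^(a - b)`. -/
def weightSum (a : Fin n →₀ ℕ) :
    AddMonoidAlgebra (ExteriorAlgebra (MvPolynomial (Fin n) K)
      (Fin P.rank → MvPolynomial (Fin n) K)) (Fin n →₀ ℕ) →ₗ[K]
    ExteriorAlgebra (MvPolynomial (Fin n) K) (Fin P.rank → MvPolynomial (Fin n) K) where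
  toFun x := x.coeff.sum fun b y => monomial (a - b) (1 : K) • y
  map_add' x y := by
    rw [AddMonoidAlgebra.coeff_add]
    exact Finsupp.sum_add_index' (fun _ => smul_zero _) (fun _ _ _ => smul_add _ _ _)
  map_smul' c x := by
    rw [AddMonoidAlgebra.coeff_smul, Finsupp.sum_smul_index' (fun _ => smul_zero _),
      Finsupp.smul_sum]
    refine Finsupp.sum_congr fun b _ => ?_
    rw [RingHom.id_apply, smul_comm]

theorem weightSum_single (a b : Fin n →₀ ℕ)
    (y : ExteriorAlgebra (MvPolynomial (Fin n) K) (Fin P.rank → MvPolynomial (Fin n) K)) :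
    P.weightSum a (AddMonoidAlgebra.single b y) = monomial (a - b) (1 : K) • y :=
  Finsupp.sum_single_index (smul_zero _)

theorem weightSum_single_mul (a g : Fin n →₀ ℕ)
    (y : ExteriorAlgebra (MvPolynomial (Fin n) K) (Fin P.rank → MvPolynomial (Fin n) K))
    (x : AddMonoidAlgebra (ExteriorAlgebra (MvPolynomial (Fin n) K)
      (Fin P.rank → MvPolynomial (Fin n) K)) (Fin n →₀ ℕ)) :
    P.weightSum a (AddMonoidAlgebra.single g y * x) = y * P.weightSum (a - g) x := by
  induction x using AddMonoidAlgebra.induction_linear with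
  | zero => simp
  | add x x' hx hx' => rw [mul_add, map_add, map_add, mul_add, hx, hx']
  | single m w =>
    rw [AddMonoidAlgebra.single_mul_single, weightSum_single, weightSum_single,
      tsub_add_eq_tsub_tsub, mul_smul_comm]

variable (v : (Fin n →₀ ℕ) → (Fin P.rank → MvPolynomial (Fin n) K))

/-- The linear extension of `g ↦ single g (ι (v g))`. -/
def homogVec : ((Fin n →₀ ℕ) →₀ K) →ₗ[K]
    AddMonoidAlgebra (ExteriorAlgebra (MvPolynomial (Fin n) K)
      (Fin P.rank → MvPolynomial (Fin n) K)) (Fin n →₀ ℕ) :=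
  Finsupp.linearCombination K fun g =>
    AddMonoidAlgebra.single g (ExteriorAlgebra.ι (MvPolynomial (Fin n) K) (v g))

theorem homogVec_mem_iotaSpan (x : (Fin n →₀ ℕ) →₀ K) :
    P.homogVec v x ∈ iotaSpan (MvPolynomial (Fin n) K)
      (Fin P.rank → MvPolynomial (Fin n) K) (Fin n →₀ ℕ) := by
  rw [homogVec, Finsupp.linearCombination_apply]
  refine sum_mem fun g _ => ?_
  have : x g • AddMonoidAlgebra.single g (ExteriorAlgebra.ι (MvPolynomial (Fin n) K) (v g)) =
      AddMonoidAlgebra.single g (ExteriorAlgebra.ι (MvPolynomial (Fin n) K) (x g • v g)) := by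
    rw [AddMonoidAlgebra.smul_single, LinearMap.map_smul_of_tower]
  simp only [this]
  exact single_mem_iotaSpan _ _

/-- The algebra homomorphism with `monGen g ↦ single g (ι (v g))`. -/
def homogAlg : MonExt K n →ₐ[K]
    AddMonoidAlgebra (ExteriorAlgebra (MvPolynomial (Fin n) K)
      (Fin P.rank → MvPolynomial (Fin n) K)) (Fin n →₀ ℕ) :=
  ExteriorAlgebra.lift K
    ⟨P.homogVec v, fun x => iotaSpan_mul_self (P.homogVec_mem_iotaSpan v x)⟩

theorem homogAlg_monGen (g : Fin n →₀ ℕ) :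
    P.homogAlg v (monGen g) = AddMonoidAlgebra.single g (ExteriorAlgebra.ι _ (v g)) := by
  rw [homogAlg, monGen, ExteriorAlgebra.lift_ι_apply, homogVec,
    Finsupp.linearCombination_single, one_smul]

/-- Homogenization of dehomogenized chains to multidegree `a`. -/
def homog (a : Fin n →₀ ℕ) : MonExt K n →ₗ[K]
    ExteriorAlgebra (MvPolynomial (Fin n) K) (Fin P.rank → MvPolynomial (Fin n) K) :=
  (P.weightSum a).comp (P.homogAlg v).toLinearMap

theorem homog_one (a : Fin n →₀ ℕ) : P.homog v a 1 = monomial a (1 : K) • 1 := by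
  change P.weightSum a (P.homogAlg v 1) = _
  rw [map_one, AddMonoidAlgebra.one_def, weightSum_single, tsub_zero]

theorem homog_monGen_mul (g c : Fin n →₀ ℕ) (w : MonExt K n) :
    P.homog v (g + c) (monGen g * w) = ExteriorAlgebra.ι _ (v g) * P.homog v c w := by
  change P.weightSum _ (P.homogAlg v _) = _ * P.weightSum _ (P.homogAlg v _)
  rw [map_mul, homogAlg_monGen, weightSum_single_mul, add_tsub_cancel_left]

/-- For a chain of exponent at most `c` no subtraction is truncated, so enlarging the target
multidegree by `b` only multiplies by `x^b`. -/
theorem homog_add_of_mem_chains (b : Fin n →₀ ℕ) {c : Fin n →₀ ℕ} {w : MonExt K n}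
    (hw : w ∈ chains A (toZ c) t) :
    P.homog v (b + c) w = monomial b (1 : K) • P.homog v c w := by
  refine chains_induction_monomial (A := A)
    (p := fun _ c w => P.homog v (b + c) w = monomial b (1 : K) • P.homog v c w)
    ?_ ?_ ?_ ?_ ?_ hw
  · intro _ _; simp
  · intro _ _ x y hx hy; rw [map_add, map_add, smul_add, hx, hy]
  · intro _ _ k x hx; rw [map_smul, map_smul, hx, smul_comm]
  · intro c
    rw [homog_one, homog_one, smul_smul, monomial_mul, mul_one]
  · intro t c g _ w _ ih
    rw [add_left_comm, homog_monGen_mul, homog_monGen_mul, ih, mul_smul_comm]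

/-- Both sides obey the same Leibniz recursion: the differential of the lift of `g` is `x^g`, which
is exactly the factor gained when `w` is homogenized to `g + c` instead of `c`. -/
theorem koszulDifferential_homog (hv : ∀ g ∈ A, P.φ (v g) = monomial g 1) {c : Fin n →₀ ℕ}
    {w : MonExt K n} (hw : w ∈ chains A (toZ c) t) :
    P.koszulDifferential (P.homog v c w) = P.homog v c (augDiff w) := by
  refine chains_induction_monomial (A := A)
    (p := fun _ c w => P.koszulDifferential (P.homog v c w) = P.homog v c (augDiff w))
    ?_ ?_ ?_ ?_ ?_ hw
  · intro _ _; simp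
  · intro _ _ x y hx hy; rw [map_add, map_add, map_add, map_add, hx, hy]
  · intro _ _ k x hx
    rw [(P.homog v _).map_smul, LinearMap.map_smul_of_tower, hx, augDiff.map_smul,
      (P.homog v _).map_smul]
  · intro c
    rw [homog_one, augDiff_one, map_zero, map_smul, koszulDifferential_one, smul_zero]
  · intro t c g hg w hw ih
    rw [homog_monGen_mul, koszulDifferential_ι_mul, hv g hg, ih, augDiff_mul, map_sub,
      homog_monGen_mul, P.homog_add_of_mem_chains v g hw]

theorem ι_mul_mem_koszulComponent {x : Fin P.rank → MvPolynomial (Fin n) K} {q s : ℕ}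
    (hx : x ∈ freeComponent K n P.deg q)
    {z : ExteriorAlgebra (MvPolynomial (Fin n) K) (Fin P.rank → MvPolynomial (Fin n) K)}
    (hz : z ∈ P.koszulComponent t s) :
    ExteriorAlgebra.ι _ x * z ∈ P.koszulComponent (t + 1) (q + s) := by
  induction hz using Submodule.span_induction with
  | mem z hz =>
    obtain ⟨i, m, p, hp, hm, rfl⟩ := hz
    rw [pi_eq_sum_univ' x, map_sum, Finset.sum_mul]
    refine Submodule.sum_mem _ fun k _ => ?_
    rw [map_smul, smul_mul_smul_comm]
    by_cases h0 : x k = 0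
    · rw [h0, zero_mul, zero_smul]; exact zero_mem _
    obtain ⟨c, hc⟩ := Finset.nonempty_of_ne_empty (mt support_eq_empty.1 h0)
    have hk : P.deg k ≤ q := by have := hx k c hc; omega
    have hhom : (x k).IsHomogeneous (q - P.deg k) := by
      intro c hc
      have := hx k c (mem_support_iff.2 hc)
      rw [Finsupp.degree_eq_weight_one] at this
      exact Nat.eq_sub_of_add_eq this
    refine Submodule.subset_span ⟨Fin.cons k i, q - P.deg k + m, x k * p, hhom.mul hp, ?_, ?_⟩
    · rw [Fin.sum_univ_succ]
      simp only [Fin.cons_zero, Fin.cons_succ]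
      omega
    · congr 1
      rw [ExteriorAlgebra.ιMulti_succ_apply]
      rfl
  | zero => rw [mul_zero]; exact zero_mem _
  | add y z _ _ hy hz => rw [mul_add]; exact add_mem hy hz
  | smul c z _ hz => rw [mul_smul_comm]; exact Submodule.smul_mem _ _ hz

theorem homog_mem_koszulComponent (hv : ∀ g, v g ∈ freeComponent K n P.deg g.degree)
    {c : Fin n →₀ ℕ} {w : MonExt K n} (hw : w ∈ chains A (toZ c) t) :
    P.homog v c w ∈ P.koszulComponent t c.degree := by
  refine chains_induction_monomial (A := A)
    (p := fun t c w => P.homog v c w ∈ P.koszulComponent t c.degree) ?_ ?_ ?_ ?_ ?_ hw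
  · intro _ _; rw [map_zero]; exact zero_mem _
  · intro _ _ x y hx hy; rw [map_add]; exact add_mem hx hy
  · intro _ _ k x hx; rw [map_smul]; exact Submodule.smul_mem _ _ hx
  · intro c
    refine Submodule.subset_span ⟨Fin.elim0, c.degree, monomial c 1,
      isHomogeneous_monomial _ rfl, by simp, ?_⟩
    rw [homog_one, ExteriorAlgebra.ιMulti_zero_apply]
  · intro t c g _ w _ ih
    rw [homog_monGen_mul, map_add]
    exact P.ι_mul_mem_koszulComponent (hv g) ih

theorem koszulComponent_le_exteriorPower {q : ℕ}
    {z : ExteriorAlgebra (MvPolynomial (Fin n) K) (Fin P.rank → MvPolynomial (Fin n) K)}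
    (hz : z ∈ P.koszulComponent t q) :
    z ∈ ExteriorAlgebra.exteriorPower (MvPolynomial (Fin n) K) t
      (Fin P.rank → MvPolynomial (Fin n) K) := by
  have : P.koszulComponent t q ≤ (ExteriorAlgebra.exteriorPower (MvPolynomial (Fin n) K) t
      (Fin P.rank → MvPolynomial (Fin n) K)).restrictScalars K := by
    refine Submodule.span_le.2 ?_
    rintro _ ⟨i, m, p, -, -, rfl⟩
    refine Submodule.smul_mem _ _ ?_
    rw [← ExteriorAlgebra.ιMulti_span_fixedDegree]
    exact Submodule.subset_span ⟨_, rfl⟩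
  exact this hz

/-- Homogenize every coefficient to its own multidegree. -/
def homogSum : MonExtAlg K n →+
    ExteriorAlgebra (MvPolynomial (Fin n) K) (Fin P.rank → MvPolynomial (Fin n) K) where
  toFun x := x.coeff.sum fun a w => P.homog v a w
  map_zero' := rfl
  map_add' x y := by
    rw [AddMonoidAlgebra.coeff_add]
    exact Finsupp.sum_add_index' (fun _ => map_zero _) (fun _ _ _ => map_add _ _ _)

theorem homogSum_single (a : Fin n →₀ ℕ) (w : MonExt K n) :
    P.homogSum v (AddMonoidAlgebra.single a w) = P.homog v a w :=
  Finsupp.sum_single_index (map_zero _)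

theorem homogSum_polyHom_mul (p : MvPolynomial (Fin n) K) {x : MonExtAlg K n}
    (hx : x ∈ chainAlg A t) : P.homogSum v (polyHom p * x) = p • P.homogSum v x := by
  induction p using MvPolynomial.induction_on' with
  | monomial r c =>
    rw [polyHom_monomial]
    induction hx using AddSubmonoid.closure_induction with
    | mem x hx =>
      obtain ⟨b, w, hw, rfl⟩ := hx
      rw [AddMonoidAlgebra.single_mul_single, homogSum_single, homogSum_single,
        ← Algebra.smul_def, map_smul, P.homog_add_of_mem_chains v r hw, ← smul_assoc,
        smul_monomial, smul_eq_mul, mul_one]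
    | zero => simp
    | add x y _ _ hx hy => rw [mul_add, map_add, map_add, smul_add, hx, hy]
  | add p q hp hq => rw [map_add, add_mul, map_add, add_smul, hp, hq]

theorem homogSum_single_monGen_mul (g : Fin n →₀ ℕ) (x : MonExtAlg K n) :
    P.homogSum v (AddMonoidAlgebra.single g (monGen g) * x) =
      ExteriorAlgebra.ι _ (v g) * P.homogSum v x := by
  induction x using AddMonoidAlgebra.induction_linear with
  | zero => simp
  | add x y hx hy => rw [mul_add, map_add, map_add, mul_add, hx, hy]
  | single m w =>
    rw [AddMonoidAlgebra.single_mul_single, homogSum_single, homogSum_single, homog_monGen_mul]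

/-! ### Homogenization is a left inverse of dehomogenization -/

theorem dehomBasis_mul_mem_chainAlg
    (hA : ∀ k, ∀ g ∈ (P.φ (Pi.single k 1)).support, g ∈ A) (k : Fin P.rank)
    {y : MonExtAlg K n} (hy : y ∈ chainAlg A t) : P.dehomBasis k * y ∈ chainAlg A (t + 1) := by
  rw [dehomBasis, Finset.sum_mul]
  refine sum_mem fun g hg => ?_
  rw [mul_assoc]
  exact polyHom_mul_mem_chainAlg _ (single_monGen_mul_mem_chainAlg (hA k g hg) hy)

theorem dehomVec_mul_mem_chainAlg
    (hA : ∀ k, ∀ g ∈ (P.φ (Pi.single k 1)).support, g ∈ A)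
    (x : Fin P.rank → MvPolynomial (Fin n) K)
    {y : MonExtAlg K n} (hy : y ∈ chainAlg A t) : P.dehomVec x * y ∈ chainAlg A (t + 1) := by
  rw [dehomVec_apply, Finset.sum_mul]
  refine sum_mem fun k _ => ?_
  rw [mul_assoc]
  exact polyHom_mul_mem_chainAlg _ (P.dehomBasis_mul_mem_chainAlg hA k hy)

theorem homogSum_dehomVec_mul
    (hA : ∀ k, ∀ g ∈ (P.φ (Pi.single k 1)).support, g ∈ A)
    (hv : ∀ k, ∑ g ∈ (P.φ (Pi.single k 1)).support,
      (P.φ (Pi.single k 1)).coeff g • v g = Pi.single k 1)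
    (x : Fin P.rank → MvPolynomial (Fin n) K)
    {y : MonExtAlg K n} (hy : y ∈ chainAlg A t) :
    P.homogSum v (P.dehomVec x * y) = ExteriorAlgebra.ι _ x * P.homogSum v y := by
  have hbasis : ∀ k, P.homogSum v (P.dehomBasis k * y) =
      ExteriorAlgebra.ι _ (Pi.single k 1) * P.homogSum v y := by
    intro k
    conv_rhs => rw [← hv k]
    rw [dehomBasis, Finset.sum_mul, map_sum, map_sum, Finset.sum_mul]
    refine Finset.sum_congr rfl fun g hg => ?_
    rw [mul_assoc, P.homogSum_polyHom_mul v _ (single_monGen_mul_mem_chainAlg (hA k g hg) hy),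
      homogSum_single_monGen_mul, LinearMap.map_smul_of_tower, smul_mul_assoc,
      ← algebraMap_eq, algebraMap_smul]
  conv_rhs => rw [pi_eq_sum_univ' x]
  rw [dehomVec_apply, Finset.sum_mul, map_sum, map_sum, Finset.sum_mul]
  refine Finset.sum_congr rfl fun k _ => ?_
  rw [mul_assoc, P.homogSum_polyHom_mul v _ (P.dehomBasis_mul_mem_chainAlg hA k hy), hbasis,
    map_smul, smul_mul_assoc]

/-- The compatibility `hv` of the lifts with the basis makes the round trip the identity on vectors,
and it propagates factor by factor. Both claims are proved together because `homogSum` is linear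
over polynomials only on chains. -/
theorem dehom_mem_chainAlg_and_homogSum_dehom
    (hA : ∀ k, ∀ g ∈ (P.φ (Pi.single k 1)).support, g ∈ A)
    (hv : ∀ k, ∑ g ∈ (P.φ (Pi.single k 1)).support,
      (P.φ (Pi.single k 1)).coeff g • v g = Pi.single k 1)
    {z : ExteriorAlgebra (MvPolynomial (Fin n) K) (Fin P.rank → MvPolynomial (Fin n) K)}
    (hz : z ∈ ExteriorAlgebra.exteriorPower (MvPolynomial (Fin n) K) t
      (Fin P.rank → MvPolynomial (Fin n) K)) :
    P.dehom z ∈ chainAlg A t ∧ P.homogSum v (P.dehom z) = z := by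
  rw [← ExteriorAlgebra.ιMulti_span_fixedDegree] at hz
  induction hz using Submodule.span_induction with
  | mem z hz =>
    obtain ⟨x, rfl⟩ := hz
    induction t with
    | zero =>
      rw [ExteriorAlgebra.ιMulti_zero_apply, map_one, AddMonoidAlgebra.one_def]
      refine ⟨AddSubmonoid.subset_closure ⟨0, 1, prod_mem_chains (l := []) rfl (by simp) le_rfl,
        rfl⟩, ?_⟩
      rw [homogSum_single, homog_one, monomial_zero', map_one, one_smul]
    | succ t ih =>
      rw [ExteriorAlgebra.ιMulti_succ_apply, dehom_ι_mul]
      obtain ⟨h1, h2⟩ := ih (Matrix.vecTail x)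
      exact ⟨P.dehomVec_mul_mem_chainAlg hA _ h1,
        by rw [P.homogSum_dehomVec_mul v hA hv _ h1, h2]⟩
  | zero => simp
  | add x y _ _ hx hy =>
    rw [map_add, map_add, hx.2, hy.2]
    exact ⟨add_mem hx.1 hy.1, rfl⟩
  | smul p x _ hx =>
    rw [map_smul, monExtAlg_smul_def, P.homogSum_polyHom_mul v p hx.1, hx.2]
    exact ⟨polyHom_mul_mem_chainAlg p hx.1, rfl⟩

/-- The Koszul cycles of a strongly stable ideal generated in degrees at most `d` are generated in
degrees at most `t * (d + 1)`. -/
theorem koszulCycles_le_span (hI : IsStronglyStable I) {d : ℕ} (hd : ∀ k, P.deg k ≤ d) (t : ℕ) :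
    P.koszulCycles t ≤ Submodule.span (MvPolynomial (Fin n) K)
      {z | z ∈ P.koszulCycles t ∧ ∃ q : ℕ, q ≤ t * (d + 1) ∧ z ∈ P.koszulComponent t q} := by
  intro z hz
  obtain ⟨v, hv1, hv2, hv3⟩ := P.exists_monomial_lift
  let G : Set (Fin n →₀ ℕ) := {g | monomial g (1 : K) ∈ I ∧ g.degree ≤ d}
  have hG : ∀ k, ∀ g ∈ (P.φ (Pi.single k 1)).support, g ∈ G := by
    intro k g hg
    refine ⟨mem_ideal_of_mem_support hI (P.φ_mem _) hg, ?_⟩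
    have := P.graded k (mem_support_iff.1 hg)
    rw [Finsupp.degree_eq_weight_one]
    exact this.trans_le (hd k)
  have hx : ∀ g ∈ G, ∀ k, g k ≠ 0 → ∀ j < k,
      g - Finsupp.single k 1 + Finsupp.single j 1 ∈ G := by
    intro g hg k hk j hj
    refine ⟨hI.exchange g hg.1 k hk j hj, ?_⟩
    have hle : Finsupp.single k 1 ≤ g := by
      rw [Finsupp.single_le_iff]
      exact Nat.one_le_iff_ne_zero.2 hk
    have h1 : g.degree = (g - Finsupp.single k 1 + Finsupp.single j 1).degree := by
      conv_lhs => rw [← tsub_add_cancel_of_le hle]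
      rw [map_add, map_add, Finsupp.degree_single, Finsupp.degree_single]
    rw [← h1]
    exact hg.2
  obtain ⟨h1, h2⟩ := P.dehom_mem_chainAlg_and_homogSum_dehom v hG hv3 hz.1
  rw [← h2]
  -- `z` is the sum of the homogenizations of its dehomogenized components, so each multidegree `a`
  -- can be treated alone.
  refine Submodule.sum_mem _ fun a _ => ?_
  have hchain := coeff_mem_of_mem_chainAlg h1 a
  have hcycle : augDiff ((P.dehom z).coeff a) = 0 := by
    have h0 : P.koszulDifferential z = 0 := hz.2
    rw [← coeff_coeffDiff, coeffDiff_dehom, h0, map_zero]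
    rfl
  have hlow := cycle_mem_lowCycles (fun g hg => hg.2) hx hchain hcycle
  change P.homog v a ((P.dehom z).coeff a) ∈ _
  revert hlow
  generalize (P.dehom z).coeff a = w
  intro hlow
  induction hlow using Submodule.span_induction with
  | mem w hw =>
    obtain ⟨c, hca, hcd, hw, hdw⟩ := hw
    obtain ⟨b, rfl⟩ := exists_add_of_le (toZ_le_toZ.1 hca)
    -- Homogenizing a low cycle to `a = b + c` gives `x^b` times its homogenization to `c`, which is
    -- a Koszul cycle of internal degree `|c|`.
    rw [add_comm c b, P.homog_add_of_mem_chains v b hw]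
    have hcomp := P.homog_mem_koszulComponent v hv1 hw
    refine Submodule.smul_mem _ _ (Submodule.subset_span
      ⟨⟨P.koszulComponent_le_exteriorPower hcomp, ?_⟩, c.degree, hcd, hcomp⟩)
    change P.koszulDifferential _ = 0
    rw [P.koszulDifferential_homog v (fun g hg => hv2 g hg.1) hw, hdw, map_zero]
  | zero => rw [map_zero]; exact zero_mem _
  | add x y _ _ hx hy => rw [map_add]; exact add_mem hx hy
  | smul c x _ hx =>
    rw [map_smul]
    exact Submodule.smul_of_tower_mem _ c hx

end MinimalPresentation

end

section

/-! ### Generator degrees are bounded by the regularity -/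

theorem mem_idealOfVars_iff_constantCoeff {p : MvPolynomial (Fin n) K} :
    p ∈ idealOfVars (Fin n) K ↔ constantCoeff p = 0 := by
  have h := mem_pow_idealOfVars_iff' 1 p
  rw [pow_one] at h
  rw [h]
  constructor
  · intro h'
    exact h' 0 (by simp)
  · intro h' x hx
    obtain rfl : x = 0 := (Finsupp.degree_eq_zero_iff x).1 (by omega)
    exact h'

namespace GradedFreeResolution

variable {I : Ideal (MvPolynomial (Fin n) K)} (F : GradedFreeResolution I)

theorem redD_apply (i : ℕ) (y : Fin (F.rank (i + 1)) → K) (l : Fin (F.rank i)) :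
    F.redD i y l = constantCoeff (F.d i (fun k => C (y k)) l) := by
  rw [redD, Matrix.toLin'_apply, ← LinearMap.toMatrix'_mulVec (F.d i)]
  simp [Matrix.mulVec, dotProduct]

theorem redComponent_le_boundaries {j : ℕ} (h : F.betti 0 j = 0) :
    F.redComponent 0 j ≤ F.boundaries 0 := by
  have hsub := Module.finrank_zero_iff.1 h
  rw [Submodule.Quotient.subsingleton_iff, Submodule.submoduleOf_eq_top] at hsub
  intro c hc
  exact (hsub (show c ∈ F.cycles 0 ⊓ F.redComponent 0 j from ⟨trivial, hc⟩)).1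

/-- Lift `p` to a vector of degree `j`. Its constant terms form a class in `(F_0 ⊗ K)_j`, hence a
boundary. Subtracting the corresponding boundary in `F_0` does not change the image and leaves
coefficients in the maximal ideal. -/
theorem mem_idealOfVars_mul_of_betti_eq_zero {j : ℕ} (h : F.betti 0 j = 0)
    {p : MvPolynomial (Fin n) K} (hp : p ∈ I) (hj : p.IsHomogeneous j) :
    p ∈ idealOfVars (Fin n) K * I := by
  have hmem : ∀ w, F.aug w ∈ I := fun w => F.range_aug.le ⟨w, rfl⟩
  obtain ⟨w₀, rfl⟩ := F.range_aug.ge hp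
  set w := freeProj (F.deg 0) j w₀ with hw
  have haug : F.aug w = F.aug w₀ := by
    rw [hw, map_freeProj (F.deg 0) F.aug F.aug_graded, homogeneousComponent_of_mem hj, if_pos rfl]
  have hred : (fun l => constantCoeff (w l)) ∈ F.redComponent 0 j := by
    intro l hl
    change coeff 0 (w l) = 0
    rw [hw, coeff_freeProj, if_neg]
    simpa using hl
  obtain ⟨y, hy⟩ := F.redComponent_le_boundaries h hred
  set u := w - F.d 0 (fun k => C (y k)) with hu
  have hzero : F.aug (F.d 0 (fun k => C (y k))) = 0 := (F.exact_zero _).2 ⟨_, rfl⟩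
  have haug' : F.aug w₀ = F.aug u := by
    rw [hu, map_sub, hzero, sub_zero, haug]
  rw [haug', map_eq_sum_mul]
  refine sum_mem fun l _ => Ideal.mul_mem_mul ?_ (hmem _)
  rw [mem_idealOfVars_iff_constantCoeff, hu, Pi.sub_apply, map_sub, ← redD_apply, hy, sub_self]

end GradedFreeResolution

namespace MinimalPresentation

variable {I : Ideal (MvPolynomial (Fin n) K)} (P : MinimalPresentation I)

/-- Otherwise `φ (e_k) = φ u` with `u ∈ 𝔪 F`. Minimality puts `e_k - u`, and hence `e_k`, into `𝔪
F`, which is absurd. -/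
theorem φ_single_notMem (k : Fin P.rank) : P.φ (Pi.single k 1) ∉ idealOfVars (Fin n) K * I := by
  intro h
  have hle : idealOfVars (Fin n) K * I ≤ Submodule.map P.φ (idealOfVars (Fin n) K • ⊤) := by
    rw [Submodule.map_smul'', Submodule.map_top, P.range_eq]
    rfl
  obtain ⟨u, hu, hφ⟩ := hle h
  have hker : Pi.single k 1 - u ∈ LinearMap.ker P.φ := by
    rw [LinearMap.mem_ker, map_sub, hφ, sub_self]
  have hmem := add_mem (P.minimal hker) hu
  rw [sub_add_cancel] at hmem
  have := constantCoeff_eq_zero_of_mem_smul_top hmem k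
  simp at this

theorem deg_le_regularity (hI : I.IsHomogeneous (homogeneousSubmodule (Fin n) K))
    (k : Fin P.rank) : (P.deg k : EReal) ≤ regularity I hI := by
  have hbetti : gradedBetti I hI 0 (P.deg k) ≠ 0 := fun h =>
    P.φ_single_notMem k
      ((resolution I hI).mem_idealOfVars_mul_of_betti_eq_zero h (P.φ_mem _) (P.graded k))
  refine le_iSup_of_le 0 ?_
  rw [Nat.cast_zero, sub_zero]
  exact le_iSup₂_of_le (P.deg k) hbetti le_rfl

end MinimalPresentation

end

end

end KoszulCycles

/-! ### The degree bound in terms of the regularity -/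

theorem proposition3p6 {K : Type*} [Field K] {n : ℕ} (I : Ideal (MvPolynomial (Fin n) K))
    (hI : KoszulCycles.IsStronglyStable I) (P : KoszulCycles.MinimalPresentation I) (t : ℕ) :
    Submodule.span (MvPolynomial (Fin n) K)
        {z | z ∈ P.koszulCycles t ∧ ∃ q : ℕ,
          (q : EReal) ≤ (t : EReal) * (KoszulCycles.regularity I hI.isHomogeneous + 1) ∧
          z ∈ P.koszulComponent t q} =
      P.koszulCycles t := by
  refine le_antisymm (Submodule.span_le.2 fun z hz => hz.1) ?_
  have hgen := P.koszulCycles_le_span hI (d := Finset.univ.sup P.deg)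
    (fun k => Finset.le_sup (Finset.mem_univ k)) t
  rcases isEmpty_or_nonempty (Fin P.rank) with hempty | hne
  -- Here `F = 0`, so no generator bounds the regularity from below. For `t = 0` the product with
  -- `0` is `0` in `EReal` whatever the regularity is; for positive `t` the exterior power vanishes.
  · cases t with
    | zero =>
      refine hgen.trans (Submodule.span_mono ?_)
      rintro z ⟨hz, q, hq, hzq⟩
      exact ⟨hz, q, by simpa using hq, hzq⟩
    | succ t =>
      intro z hz
      have hz' := hz.1
      rw [← ExteriorAlgebra.ιMulti_span_fixedDegree] at hz'
      have h0 : Submodule.span (MvPolynomial (Fin n) K)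
          (Set.range (ExteriorAlgebra.ιMulti (MvPolynomial (Fin n) K)
            (M := Fin P.rank → MvPolynomial (Fin n) K) (t + 1))) = ⊥ := by
        rw [Submodule.span_eq_bot]
        rintro _ ⟨v, rfl⟩
        exact AlternatingMap.map_coord_zero _ 0 (Subsingleton.elim _ _)
      obtain rfl : z = 0 := (Submodule.mem_bot _).1 (h0.le hz')
      exact zero_mem _
  · refine hgen.trans (Submodule.span_mono ?_)
    rintro z ⟨hz, q, hq, hzq⟩
    refine ⟨hz, q, ?_, hzq⟩
    -- The supremum of the degrees is attained at some generator, so the comparison of that degree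
    -- with the regularity applies.
    obtain ⟨k, -, hk⟩ := Finset.exists_mem_eq_sup Finset.univ Finset.univ_nonempty P.deg
    rw [hk] at hq
    calc (q : EReal) ≤ ((t * (P.deg k + 1) : ℕ) : EReal) := by exact_mod_cast hq
      _ = (t : EReal) * ((P.deg k : EReal) + 1) := by push_cast; rfl
      _ ≤ _ := mul_le_mul_of_nonneg_left
        (add_le_add_left (P.deg_le_regularity hI.isHomogeneous k) 1) t.cast_nonneg'
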